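/- Let $\mathcal{A}$ be a Frobenius abelian category, i.e. an abelian category with enough projectives and enough injectives whose projective and injective objects coincide, and let $\mathcal{P}$ be its class of projective (= injective) objects. Let $\underline{\mathcal{A}}=\mathcal{A}/\mathcal{P}$ be the stable category (same objects; morphisms modulo those factoring through an object of $\mathcal{P}$), with its standard triangulated structure: the suspension $\Sigma=\Omega^{-1}$ sends $X$ to the cokernel of a monomorphism from $X$ into an injective object, its inverse, the loop functor $\Omega$, sends $X$ to the kernel of an epimorphism from a projective object onto $X$, and the distinguished triangles are those isomorphic to the standard triangles $X\to Y\to \mathrm{cone}(f)\to\Sigma X$ of morphisms $f:X\to Y$ of $\mathcal{A}$, where $\mathrm{cone}(f)$ is the pushout of $f$ along a monomorphism from $X$ into an injective object. Suppose that $\underline{\mathcal{A}}$ has split idempotents. All subcategories are full and closed under isomorphisms; for a subcategory $\mathcal{X}\subseteq\mathcal{A}$, $\underline{\mathcal{X}}$ denotes its image in $\underline{\mathcal{A}}$ (closed under isomorphisms). A subcategory is resolving (resp. coresolving) if it contains the projective (resp. injective) objects and is closed under extensions and kernels of epimorphisms (resp. cokernels of monomorphisms). It is precovering (resp. preenveloping)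 if every object $M$ of $\mathcal{A}$ admits a morphism $X\to M$ (resp. $M\to X$) with $X\in\mathcal{X}$ through which every morphism from an object of $\mathcal{X}$ to $M$ (resp. from $M$ to an object of $\mathcal{X}$) factors. A complete cotorsion pair is a pair $(\mathcal{Z},\mathcal{W})$ of classes of objects such that $\mathcal{W}=\{Y:\operatorname{Ext}^1(Z,Y)=0\ \forall Z\in\mathcal{Z}\}$, $\mathcal{Z}=\{X:\operatorname{Ext}^1(X,W)=0\ \forall W\in\mathcal{W}\}$, and every object $M$ admits short exact sequences $0\to W\to Z\to M\to 0$ and $0\to M\to W'\to Z'\to 0$ with $Z,Z'\in\mathcal{Z}$, $W,W'\in\mathcal{W}$. A t-structure $(\mathcal{U},\Sigma\mathcal{V})$ in $\underline{\mathcal{A}}$ consists of subcategories $\mathcal{U},\mathcal{V}$ such that $\underline{\mathcal{A}}(U,V)=0$ for all $U\in\mathcal{U}$, $V\in\mathcal{V}$, $\Sigma\mathcal{U}\subseteq\mathcal{U}$, $\Sigma^{-1}\mathcal{V}\subseteq\mathcal{V}$, and every object $M$ lies in a distinguished triangle $U\to M\to V\to\Sigma U$ with $U\in\mathcal{U}$,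 $V\in\mathcal{V}$. For a subcategory $\mathcal{X}\subseteq\mathcal{A}$ the following hold: 1. $\mathcal{X}$ is a preenveloping resolving subcategory of $\mathcal{A}$ closed under direct summands if and only if there is a complete cotorsion pair $(\mathcal{Z},\mathcal{X})$ in $\mathcal{A}$ and $\Omega(\underline{\mathcal{X}})\subseteq\underline{\mathcal{X}}$. 2. $\mathcal{X}$ is a precovering coresolving subcategory of $\mathcal{A}$ closed under direct summands if and only if there is a complete cotorsion pair $(\mathcal{X},\mathcal{Y})$ in $\mathcal{A}$ and $\Omega^{-1}(\underline{\mathcal{X}})\subseteq\underline{\mathcal{X}}$. Moreover, a complete cotorsion pair $(\mathcal{Z},\mathcal{W})$ satisfies $\Omega^{-1}(\underline{\mathcal{Z}})\subseteq\underline{\mathcal{Z}}$ if and only if $\Omega(\underline{\mathcal{W}})\subseteq\underline{\mathcal{W}}$, and the following four classes are in bijection: - (a) precovering coresolving subcategories of $\mathcal{A}$ closed under direct summands; - (b) t-structures $(\mathcal{U},\Sigma\mathcal{V})$ in $\underline{\mathcal{A}}$; - (c) preenveloping resolving subcategories of $\mathcal{A}$ closed under direct summands; - (d) complete cotorsion pairs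 $(\mathcal{Z},\mathcal{W})$ in $\mathcal{A}$ such that $\Omega^{-1}(\underline{\mathcal{Z}})\subseteq\underline{\mathcal{Z}}$. Explicitly, there are bijections from (a), (c) and (d) to (b): the one from (a) sends $\mathcal{X}$ to the t-structure with $\mathcal{U}=\underline{\mathcal{X}}$, the one from (c) sends $\mathcal{X}$ to the t-structure with $\mathcal{V}=\underline{\mathcal{X}}$, and the one from (d) sends $(\mathcal{Z},\mathcal{W})$ to the t-structure with $\mathcal{U}=\underline{\mathcal{Z}}$. -/

import Mathlib

open CategoryTheory CategoryTheory.Limits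
open scoped ZeroObject

universe v u

noncomputable section

namespace FrobeniusStable

/-! ## Frobenius abelian categories and their stable categories -/

/-- An abelian category is Frobenius if it has enough projectives, enough injectives,
and its projective objects coincide with its injective objects. -/
class IsFrobenius (A : Type u) [Category.{v} A] [Abelian A] : Prop where
  enoughProjectives : EnoughProjectives A
  enoughInjectives : EnoughInjectives A
  projective_iff_injective : ∀ X : A, Projective X ↔ Injective X

attribute [instance] IsFrobenius.enoughProjectives IsFrobenius.enoughInjectives

variable {A : Type u} [Category.{v} A] [Abelian A]

/-- A morphism factors through a projective object. -/
def FactorsThruProjective {X Y : A} (f : X ⟶ Y) : Prop :=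
  ∃ (P : A) (_ : Projective P) (a : X ⟶ P) (b : P ⟶ Y), a ≫ b = f

lemma FactorsThruProjective.zero (X Y : A) : FactorsThruProjective (0 : X ⟶ Y) :=
  ⟨0, inferInstance, 0, 0, by simp⟩

lemma FactorsThruProjective.neg {X Y : A} {f : X ⟶ Y} (hf : FactorsThruProjective f) :
    FactorsThruProjective (-f) := by
  obtain ⟨P, hP, a, b, rfl⟩ := hf
  exact ⟨P, hP, -a, b, by simp⟩

lemma FactorsThruProjective.add {X Y : A} {f g : X ⟶ Y} (hf : FactorsThruProjective f)
    (hg : FactorsThruProjective g) : FactorsThruProjective (f + g) := by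
  obtain ⟨P, hP, a, b, rfl⟩ := hf
  obtain ⟨Q, hQ, c, d, rfl⟩ := hg
  exact ⟨P ⊞ Q, inferInstance, biprod.lift a c, biprod.desc b d, by simp⟩

lemma FactorsThruProjective.precomp {W X Y : A} (h : W ⟶ X) {f : X ⟶ Y}
    (hf : FactorsThruProjective f) : FactorsThruProjective (h ≫ f) := by
  obtain ⟨P, hP, a, b, rfl⟩ := hf
  exact ⟨P, hP, h ≫ a, b, by simp⟩

lemma FactorsThruProjective.postcomp {X Y Z : A} {f : X ⟶ Y}
    (hf : FactorsThruProjective f) (h : Y ⟶ Z) : FactorsThruProjective (f ≫ h) := by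
  obtain ⟨P, hP, a, b, rfl⟩ := hf
  exact ⟨P, hP, a, b ≫ h, by simp⟩

variable (A) in
/-- Two parallel morphisms are stably equal if their difference factors through a
projective object. -/
def stableRel : HomRel A := fun _ _ f g => FactorsThruProjective (f - g)

instance stableRel_congruence : Congruence (stableRel A) where
  equivalence :=
    { refl := fun f => by
        simpa [stableRel] using FactorsThruProjective.zero _ _
      symm := fun {f g} h => by
        simpa [stableRel] using FactorsThruProjective.neg h
      trans := fun {f g k} h₁ h₂ => by
        simpa [stableRel] using FactorsThruProjective.add h₁ h₂ }
  comp_left := fun h f g hfg => by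
    simpa [stableRel] using FactorsThruProjective.precomp h hfg
  comp_right := fun h hfg => by
    simpa [stableRel] using FactorsThruProjective.postcomp hfg h

lemma stableRel_add ⦃X Y : A⦄ (f₁ f₂ g₁ g₂ : X ⟶ Y) (hf : stableRel A f₁ f₂)
    (hg : stableRel A g₁ g₂) : stableRel A (f₁ + g₁) (f₂ + g₂) := by
  have h := FactorsThruProjective.add hf hg
  have e : f₁ - f₂ + (g₁ - g₂) = f₁ + g₁ - (f₂ + g₂) := by abel
  rw [e] at h
  exact h

variable (A) in
/-- The stable category of `A`: the same objects, and morphisms modulo those that factor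
through a projective object. -/
abbrev StableCategory : Type u := CategoryTheory.Quotient (stableRel A)

instance stablePreadditive : Preadditive (StableCategory A) :=
  CategoryTheory.Quotient.preadditive (stableRel A) stableRel_add

variable (A) in
/-- The projection functor from `A` to its stable category. -/
abbrev toStable : A ⥤ StableCategory A := CategoryTheory.Quotient.functor (stableRel A)

/-! ## The suspension and loop functors -/

section Functors

variable [IsFrobenius A]

/-- The cosyzygy of `X`: the cokernel of a chosen monomorphism of `X` into an
injective object. -/
abbrev cosyzygy (X : A) : A := cokernel (Injective.ι X)

/-- The syzygy of `X`: the kernel of a chosen epimorphism from a projective object to `X`. -/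
abbrev syzygy (X : A) : A := kernel (Projective.π X)

/-- A chosen extension of `f` to the chosen injective objects. -/
def underMap {X Y : A} (f : X ⟶ Y) : Injective.under X ⟶ Injective.under Y :=
  Injective.factorThru (f ≫ Injective.ι Y) (Injective.ι X)

lemma ι_underMap {X Y : A} (f : X ⟶ Y) :
    Injective.ι X ≫ underMap f = f ≫ Injective.ι Y :=
  Injective.comp_factorThru _ _

/-- The morphism induced by `f` on cosyzygies by the chosen extension. -/
def cosyzygyMap {X Y : A} (f : X ⟶ Y) : cosyzygy X ⟶ cosyzygy Y :=
  cokernel.map (Injective.ι X) (Injective.ι Y) f (underMap f) (ι_underMap f)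

/-- A chosen lift of `f` to the chosen projective objects. -/
def overMap {X Y : A} (f : X ⟶ Y) : Projective.over X ⟶ Projective.over Y :=
  Projective.factorThru (Projective.π X ≫ f) (Projective.π Y)

lemma overMap_π {X Y : A} (f : X ⟶ Y) :
    overMap f ≫ Projective.π Y = Projective.π X ≫ f :=
  Projective.factorThru_comp _ _

/-- The morphism induced by `f` on syzygies by the chosen lift. -/
def syzygyMap {X Y : A} (f : X ⟶ Y) : syzygy X ⟶ syzygy Y :=
  kernel.map (Projective.π X) (Projective.π Y) (overMap f) f (overMap_π f).symm

/-- Stably equal morphisms induce stably equal morphisms on cosyzygies, whatever the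
extensions to the injective objects. -/
lemma cosyzygy_stableRel {X Y : A} {f g : X ⟶ Y} (hfg : stableRel A f g)
    {a b : Injective.under X ⟶ Injective.under Y}
    (ha : Injective.ι X ≫ a = f ≫ Injective.ι Y) (hb : Injective.ι X ≫ b = g ≫ Injective.ι Y)
    {s t : cosyzygy X ⟶ cosyzygy Y}
    (hs : cokernel.π _ ≫ s = a ≫ cokernel.π (Injective.ι Y))
    (ht : cokernel.π _ ≫ t = b ≫ cokernel.π (Injective.ι Y)) : stableRel A s t := by
  obtain ⟨P, hP, p, q, hpq⟩ := hfg
  have hP' : Injective P := (IsFrobenius.projective_iff_injective P).1 hP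
  let p' : Injective.under X ⟶ P := Injective.factorThru p (Injective.ι X)
  have hp' : Injective.ι X ≫ p' = p := Injective.comp_factorThru _ _
  have w : Injective.ι X ≫ (a - b - p' ≫ q ≫ Injective.ι Y) = 0 := by
    rw [Preadditive.comp_sub, Preadditive.comp_sub, ha, hb, reassoc_of% hp', reassoc_of% hpq,
      Preadditive.sub_comp, sub_self]
  refine ⟨Injective.under Y, (IsFrobenius.projective_iff_injective _).2 inferInstance,
    cokernel.desc _ _ w, cokernel.π _, ?_⟩
  rw [← cancel_epi (cokernel.π (Injective.ι X)), cokernel.π_desc_assoc, Preadditive.comp_sub,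
    hs, ht]
  simp [Preadditive.sub_comp]

/-- Stably equal morphisms induce stably equal morphisms on syzygies, whatever the
lifts to the projective objects. -/
lemma syzygy_stableRel {X Y : A} {f g : X ⟶ Y} (hfg : stableRel A f g)
    {a b : Projective.over X ⟶ Projective.over Y}
    (ha : a ≫ Projective.π Y = Projective.π X ≫ f) (hb : b ≫ Projective.π Y = Projective.π X ≫ g)
    {s t : syzygy X ⟶ syzygy Y}
    (hs : s ≫ kernel.ι _ = kernel.ι (Projective.π X) ≫ a)
    (ht : t ≫ kernel.ι _ = kernel.ι (Projective.π X) ≫ b) : stableRel A s t := by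
  obtain ⟨P, hP, p, q, hpq⟩ := hfg
  let q' : P ⟶ Projective.over Y := Projective.factorThru q (Projective.π Y)
  have hq' : q' ≫ Projective.π Y = q := Projective.factorThru_comp _ _
  have w : (a - b - Projective.π X ≫ p ≫ q') ≫ Projective.π Y = 0 := by
    simp only [Preadditive.sub_comp, Category.assoc, ha, hb, hq', hpq, Preadditive.comp_sub,
      sub_self]
  refine ⟨Projective.over X, inferInstance, kernel.ι _, kernel.lift _ _ w, ?_⟩
  rw [← cancel_mono (kernel.ι (Projective.π Y)), Category.assoc, kernel.lift_ι,
    Preadditive.sub_comp, hs, ht]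
  simp [Preadditive.comp_sub]

variable (A) in
/-- The suspension functor `Σ = Ω⁻¹` of the stable category, given on objects by cosyzygies. -/
def suspension : StableCategory A ⥤ StableCategory A :=
  CategoryTheory.Quotient.lift (stableRel A)
    { obj := fun X => (toStable A).obj (cosyzygy X)
      map := fun f => (toStable A).map (cosyzygyMap f)
      map_id := fun X => by
        rw [← (toStable A).map_id]
        refine CategoryTheory.Quotient.sound _ (cosyzygy_stableRel (f := 𝟙 X) (g := 𝟙 X)
          (stableRel_congruence.equivalence.refl _) (a := underMap (𝟙 X)) (b := 𝟙 _)
          (ι_underMap _) (by simp) (by simp [cosyzygyMap]) (by simp))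
      map_comp := fun {X Y Z} f g => by
        rw [← (toStable A).map_comp]
        refine CategoryTheory.Quotient.sound _ (cosyzygy_stableRel (f := f ≫ g) (g := f ≫ g)
          (stableRel_congruence.equivalence.refl _) (a := underMap (f ≫ g))
          (b := underMap f ≫ underMap g) (ι_underMap _) ?_ (by simp [cosyzygyMap])
          (by simp [cosyzygyMap]))
        rw [← Category.assoc, ι_underMap, Category.assoc, ι_underMap, Category.assoc] }
    (fun _ _ f g h => CategoryTheory.Quotient.sound _ (cosyzygy_stableRel h (ι_underMap f) (ι_underMap g)
      (by simp [cosyzygyMap]) (by simp [cosyzygyMap])))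

variable (A) in
/-- The loop functor `Ω` of the stable category, given on objects by syzygies. -/
def loop : StableCategory A ⥤ StableCategory A :=
  CategoryTheory.Quotient.lift (stableRel A)
    { obj := fun X => (toStable A).obj (syzygy X)
      map := fun f => (toStable A).map (syzygyMap f)
      map_id := fun X => by
        rw [← (toStable A).map_id]
        refine CategoryTheory.Quotient.sound _ (syzygy_stableRel (f := 𝟙 X) (g := 𝟙 X)
          (stableRel_congruence.equivalence.refl _) (a := overMap (𝟙 X)) (b := 𝟙 _)
          (overMap_π _) (by simp) (by simp [syzygyMap]) (by simp))
      map_comp := fun {X Y Z} f g => by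
        rw [← (toStable A).map_comp]
        refine CategoryTheory.Quotient.sound _ (syzygy_stableRel (f := f ≫ g) (g := f ≫ g)
          (stableRel_congruence.equivalence.refl _) (a := overMap (f ≫ g))
          (b := overMap f ≫ overMap g) (overMap_π _) ?_ (by simp [syzygyMap])
          (by simp [syzygyMap]))
        rw [Category.assoc, overMap_π, ← Category.assoc, overMap_π, Category.assoc] }
    (fun _ _ f g h => CategoryTheory.Quotient.sound _ (syzygy_stableRel h (overMap_π f) (overMap_π g)
      (by simp [syzygyMap]) (by simp [syzygyMap])))

/-! ## Distinguished triangles and t-structures -/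

/-- The cone of a morphism `f : X ⟶ Y` of `A`: the pushout of `f` along the chosen
monomorphism of `X` into an injective object. -/
abbrev cone {X Y : A} (f : X ⟶ Y) : A := pushout f (Injective.ι X)

/-- The connecting morphism from the cone of `f : X ⟶ Y` to the cosyzygy of `X`. -/
def coneConnecting {X Y : A} (f : X ⟶ Y) : cone f ⟶ cosyzygy X :=
  pushout.desc 0 (cokernel.π (Injective.ι X)) (by simp)

/-- The distinguished triangles `X ⟶ Y ⟶ Z ⟶ ΣX` of the stable category: those isomorphic
to the image of `X' ⟶ Y' ⟶ cone f ⟶ cosyzygy X'` for some morphism `f : X' ⟶ Y'` of `A`. -/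
def IsDistinguished {X Y Z : StableCategory A} (f : X ⟶ Y) (g : Y ⟶ Z)
    (h : Z ⟶ (suspension A).obj X) : Prop :=
  ∃ (X' Y' : A) (f' : X' ⟶ Y') (a : X ≅ (toStable A).obj X') (b : Y ≅ (toStable A).obj Y')
    (c : Z ≅ (toStable A).obj (cone f')),
    f ≫ b.hom = a.hom ≫ (toStable A).map f' ∧
    g ≫ c.hom = b.hom ≫ (toStable A).map (pushout.inl f' (Injective.ι X')) ∧
    h ≫ (suspension A).map a.hom = c.hom ≫ (toStable A).map (coneConnecting f')

variable (A) in
/-- A t-structure `(U, ΣV)` in the stable category of `A`, with aisle `U` and with `V`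
the class of those `Y` such that `ΣY` lies in the second component; so `U` plays the role
of `D^{≤ 0}` and `V` that of `D^{≥ 1}`. All subcategories are full and closed under
isomorphisms. -/
@[ext]
structure TStructure where
  /-- the aisle `U` -/
  U : ObjectProperty (StableCategory A)
  /-- the class `V` -/
  V : ObjectProperty (StableCategory A)
  U_iso : U.IsClosedUnderIsomorphisms
  V_iso : V.IsClosedUnderIsomorphisms
  hom_eq_zero : ∀ ⦃X Y : StableCategory A⦄ (f : X ⟶ Y), U X → V Y → f = 0
  /-- `ΣU ⊆ U` -/
  U_suspension : ∀ X, U X → U ((suspension A).obj X)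
  /-- `Σ⁻¹V ⊆ V` -/
  V_desuspension : ∀ X, V ((suspension A).obj X) → V X
  exists_triangle : ∀ M : StableCategory A, ∃ (X Y : StableCategory A) (_ : U X) (_ : V Y)
    (f : X ⟶ M) (g : M ⟶ Y) (h : Y ⟶ (suspension A).obj X), IsDistinguished f g h

/-- The full subcategory of the stable category given by a subcategory `X` of `A`, closed
under isomorphisms. -/
abbrev stableImage (X : ObjectProperty A) : ObjectProperty (StableCategory A) :=
  X.map (toStable A)

/-- `Ω` maps the stable image of `X` into itself. -/
def IsLoopClosed (X : ObjectProperty A) : Prop :=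
  ∀ M, stableImage X M → stableImage X ((loop A).obj M)

/-- `Ω⁻¹` maps the stable image of `X` into itself. -/
def IsSuspensionClosed (X : ObjectProperty A) : Prop :=
  ∀ M, stableImage X M → stableImage X ((suspension A).obj M)

end Functors

/-! ## Subcategories of an abelian category -/

/-- Every object `M` has an `X`-precover: a morphism from an object of `X` to `M` through which
every morphism from an object of `X` to `M` factors. -/
def IsPrecovering (X : ObjectProperty A) : Prop :=
  ∀ M : A, ∃ (C : A) (p : C ⟶ M), X C ∧
    ∀ (D : A) (f : D ⟶ M), X D → ∃ g : D ⟶ C, g ≫ p = f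

/-- Every object `M` has an `X`-preenvelope: a morphism from `M` to an object of `X` through which
every morphism from `M` to an object of `X` factors. -/
def IsPreenveloping (X : ObjectProperty A) : Prop :=
  ∀ M : A, ∃ (C : A) (j : M ⟶ C), X C ∧
    ∀ (D : A) (f : M ⟶ D), X D → ∃ g : C ⟶ D, j ≫ g = f

/-- Resolving subcategories: they contain the projective objects and are closed under extensions
and under kernels of epimorphisms. (In particular they contain zero and are closed under
isomorphisms and finite direct sums.) -/
structure IsResolving (X : ObjectProperty A) : Prop where
  projective : ∀ P : A, Projective P → X P
  extension : ∀ S : ShortComplex A, S.ShortExact → X S.X₁ → X S.X₃ → X S.X₂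
  kernel : ∀ S : ShortComplex A, S.ShortExact → X S.X₂ → X S.X₃ → X S.X₁

/-- Coresolving subcategories: they contain the injective objects and are closed under extensions
and under cokernels of monomorphisms. -/
structure IsCoresolving (X : ObjectProperty A) : Prop where
  injective : ∀ I : A, Injective I → X I
  extension : ∀ S : ShortComplex A, S.ShortExact → X S.X₁ → X S.X₃ → X S.X₂
  cokernel : ∀ S : ShortComplex A, S.ShortExact → X S.X₁ → X S.X₂ → X S.X₃

/-- `Ext¹(X, Y) = 0`. -/
def ExtOneVanishes (X Y : A) : Prop :=
  letI := HasExt.standard A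
  Subsingleton (Abelian.Ext.{max u v} X Y 1)

/-- `(Z, W)` is a complete cotorsion pair. -/
structure IsCompleteCotorsionPair (Z W : ObjectProperty A) : Prop where
  /-- `Z^⊥ = W` -/
  right_perp : ∀ Y : A, W Y ↔ ∀ X : A, Z X → ExtOneVanishes X Y
  /-- `^⊥W = Z` -/
  left_perp : ∀ X : A, Z X ↔ ∀ Y : A, W Y → ExtOneVanishes X Y
  /-- a short exact sequence `0 ⟶ Y ⟶ X ⟶ M ⟶ 0` with `X` in `Z` and `Y` in `W` -/
  exists_left : ∀ M : A, ∃ (Y X : A) (i : Y ⟶ X) (p : X ⟶ M) (w : i ≫ p = 0),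
    Z X ∧ W Y ∧ (ShortComplex.mk i p w).ShortExact
  /-- a short exact sequence `0 ⟶ M ⟶ Y ⟶ X ⟶ 0` with `X` in `Z` and `Y` in `W` -/
  exists_right : ∀ M : A, ∃ (Y X : A) (i : M ⟶ Y) (p : Y ⟶ X) (w : i ≫ p = 0),
    Z X ∧ W Y ∧ (ShortComplex.mk i p w).ShortExact

variable (A) in
/-- Precovering coresolving subcategories closed under direct summands. -/
abbrev PrecoveringCoresolving : Type u :=
  {X : ObjectProperty A // IsPrecovering X ∧ IsCoresolving X ∧ X.IsStableUnderRetracts}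

variable (A) in
/-- Preenveloping resolving subcategories closed under direct summands. -/
abbrev PreenvelopingResolving : Type u :=
  {X : ObjectProperty A // IsPreenveloping X ∧ IsResolving X ∧ X.IsStableUnderRetracts}

variable (A) in
/-- Complete cotorsion pairs `(Z, W)` with `Ω⁻¹(Z) ⊆ Z` in the stable category. -/
abbrev SuspensionClosedCotorsionPair [IsFrobenius A] : Type u :=
  {p : ObjectProperty A × ObjectProperty A //
    IsCompleteCotorsionPair p.1 p.2 ∧ IsSuspensionClosed p.1}

end FrobeniusStable

end

open FrobeniusStable

noncomputable section

namespace FrobeniusStable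

section

variable {A : Type u} [Category.{v} A] [Abelian A]

/-! ## Stably zero morphisms -/

/-! In a Frobenius category `Ext¹(X, Y)` is the group of stable morphisms `X ⟶ ΣY`, equivalently `ΩX
⟶ Y`. Both halves of a cotorsion pair are therefore orthogonal classes in the stable category. As
such they are closed under stable retracts, so they are determined by their stable images. An
orthogonal class that is closed under the relevant shift is coresolving (on the left) or resolving
(on the right), and `Ext¹(ΣX, Y)` and `Ext¹(X, ΩY)` vanish together. This gives everything that
starts from a cotorsion pair `(Z, W)`: its approximation sequences become the triangles of a
t-structure, with `U = Z` and `V = ΣW`, or with `V = W` and `U = ΩZ` after one rotation.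

The substance is the converse: a precovering coresolving class `X` closed under summands has special
precovers. A precover is only a weak coreflection. A precover of its kernel yields a cone `D` in `X`
over `M` and an endomorphism of `D` that is idempotent in the stable category. Splitting it gives a
genuine stable coreflection `U ⟶ M` (`exists_stable_coreflection`). A Wakamatsu-type argument then
shows that its kernel is right `Ext¹`-orthogonal to `X` (`extOneVanishes_of_stable_coreflection`),
and Salce's trick supplies the other approximations. The preenveloping case is dual.

Conversely, the two classes of a t-structure are stable orthogonals of each other
(`TStructure.objU_eq`, `TStructure.objV_eq`), and its triangles give precovers by `U` and
preenvelopes by `V`. This is the surjectivity of the bijections. -/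

lemma toStable_map_eq_iff {X Y : A} (f g : X ⟶ Y) :
    (toStable A).map f = (toStable A).map g ↔ FactorsThruProjective (f - g) :=
  CategoryTheory.Quotient.functor_map_eq_iff (stableRel A) f g

instance : (toStable A).Additive :=
  CategoryTheory.Quotient.functor_additive (stableRel A) stableRel_add

lemma toStable_map_eq_zero_iff {X Y : A} (f : X ⟶ Y) :
    (toStable A).map f = 0 ↔ FactorsThruProjective f := by
  rw [← (toStable A).map_zero, toStable_map_eq_iff, sub_zero]

lemma exists_toStable_map_eq {X Y : A} (f : (toStable A).obj X ⟶ (toStable A).obj Y) :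
    ∃ g : X ⟶ Y, (toStable A).map g = f :=
  (toStable A).map_surjective f

lemma FactorsThruProjective.sub {X Y : A} {f g : X ⟶ Y} (hf : FactorsThruProjective f)
    (hg : FactorsThruProjective g) : FactorsThruProjective (f - g) := by
  rw [sub_eq_add_neg]
  exact hf.add hg.neg

lemma FactorsThruProjective.of_projective_source {X Y : A} [Projective X] (f : X ⟶ Y) :
    FactorsThruProjective f :=
  ⟨X, inferInstance, 𝟙 X, f, by simp⟩

lemma FactorsThruProjective.of_projective_target {X Y : A} [Projective Y] (f : X ⟶ Y) :
    FactorsThruProjective f :=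
  ⟨Y, inferInstance, f, 𝟙 Y, by simp⟩

/-- The intermediate projective lifts along `p`. With the dual `exists_extend`, this is the device
that corrects an equality holding only stably into an equality in `A`. -/
lemma FactorsThruProjective.exists_lift {X Y Z : A} {f : X ⟶ Y} (hf : FactorsThruProjective f)
    (p : Z ⟶ Y) [Epi p] : ∃ g : X ⟶ Z, FactorsThruProjective g ∧ g ≫ p = f := by
  obtain ⟨P, hP, a, b, rfl⟩ := hf
  exact ⟨a ≫ Projective.factorThru b p, ⟨P, hP, _, _, rfl⟩, by simp⟩

lemma FactorsThruProjective.exists_extend [IsFrobenius A] {X Y Z : A} {f : X ⟶ Y}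
    (hf : FactorsThruProjective f) (i : X ⟶ Z) [Mono i] :
    ∃ g : Z ⟶ Y, FactorsThruProjective g ∧ i ≫ g = f := by
  obtain ⟨P, hP, a, b, rfl⟩ := hf
  have : Injective P := (IsFrobenius.projective_iff_injective P).1 hP
  exact ⟨Injective.factorThru a i ≫ b, ⟨P, hP, _, _, rfl⟩, by simp⟩

lemma projective_of_injective [IsFrobenius A] (X : A) [Injective X] : Projective X :=
  (IsFrobenius.projective_iff_injective X).2 inferInstance

lemma injective_of_projective [IsFrobenius A] (X : A) [Projective X] : Injective X :=
  (IsFrobenius.projective_iff_injective X).1 inferInstance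

lemma projective_of_factorsThruProjective_id {X : A} (h : FactorsThruProjective (𝟙 X)) :
    Projective X := by
  obtain ⟨P, hP, a, b, hab⟩ := h
  exact Retract.projective ⟨a, b, hab⟩

/-- A retract in the stable category comes from a retract up to a projective summand. -/
lemma exists_retract_biprod {X Y : A} {f : X ⟶ Y} {g : Y ⟶ X}
    (h : FactorsThruProjective (f ≫ g - 𝟙 X)) :
    ∃ P : A, Projective P ∧ Nonempty (Retract X (Y ⊞ P)) := by
  obtain ⟨P, hP, a, b, hab⟩ := h
  exact ⟨P, hP, ⟨⟨biprod.lift f a, biprod.desc g (-b), by simp [hab]⟩⟩⟩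

/-! ## Pullbacks and pushouts of short exact sequences -/

lemma exists_shortExact_of_isPullback {S : ShortComplex A} (hS : S.ShortExact) {E B : A}
    {p : E ⟶ B} {b : E ⟶ S.X₂} {k : B ⟶ S.X₃} (sq : IsPullback p b k S.g) :
    ∃ (i : S.X₁ ⟶ E) (w : i ≫ p = 0), i ≫ b = S.f ∧ (ShortComplex.mk i p w).ShortExact := by
  have := hS.mono_f
  have := hS.epi_g
  have hf := hS.fIsKernel
  refine ⟨sq.lift 0 S.f (by simp), by simp, by simp, ?_⟩
  have hm : Mono (sq.lift 0 S.f (by simp)) := mono_of_mono_fac (sq.lift_snd _ _ _)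
  have he : Epi p := by
    have := Abelian.epi_fst_of_isLimit k S.g sq.isLimit
    exact this
  refine { exact := ShortComplex.exact_of_f_is_kernel _ ?_, mono_f := hm, epi_g := he }
  refine KernelFork.IsLimit.ofι' _ _ (fun {T} x hx => ⟨KernelFork.IsLimit.lift' hf (x ≫ b)
    (by rw [Category.assoc, ← sq.w, reassoc_of% hx, zero_comp]) |>.1, ?_⟩)
  apply sq.hom_ext
  · simpa using hx.symm
  · simpa using (KernelFork.IsLimit.lift' hf (x ≫ b)
      (by rw [Category.assoc, ← sq.w, reassoc_of% hx, zero_comp])).2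

lemma exists_shortExact_of_isPushout {S : ShortComplex A} (hS : S.ShortExact) {E B : A}
    {k : S.X₁ ⟶ B} {i : B ⟶ E} {b : S.X₂ ⟶ E} (sq : IsPushout k S.f i b) :
    ∃ (p : E ⟶ S.X₃) (w : i ≫ p = 0), b ≫ p = S.g ∧ (ShortComplex.mk i p w).ShortExact := by
  have := hS.mono_f
  have := hS.epi_g
  have hg := hS.gIsCokernel
  refine ⟨sq.desc 0 S.g (by simp), by simp, by simp, ?_⟩
  have he : Epi (sq.desc 0 S.g (by simp)) := epi_of_epi_fac (sq.inr_desc _ _ _)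
  have hm : Mono i := by
    have := Abelian.mono_inl_of_isColimit k S.f sq.isColimit
    exact this
  refine { exact := ShortComplex.exact_of_g_is_cokernel _ ?_, mono_f := hm, epi_g := he }
  refine CokernelCofork.IsColimit.ofπ' _ _ (fun {T} x hx =>
    ⟨CokernelCofork.IsColimit.desc' hg (b ≫ x)
    (by rw [← Category.assoc, ← sq.w, Category.assoc, hx, comp_zero]) |>.1, ?_⟩)
  apply sq.hom_ext
  · simpa using hx.symm
  · simpa using (CokernelCofork.IsColimit.desc' hg (b ≫ x)
      (by rw [← Category.assoc, ← sq.w, Category.assoc, hx, comp_zero])).2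

/-- If `U ⟶ M` is an epimorphism with kernel `Y` and `U ⟶ I` is a monomorphism, then the pushout
of the two has `Y ⟶ I` as kernel. -/
lemma shortExact_of_isPushout_of_epi {S : ShortComplex A} (hS : S.ShortExact) {I E : A}
    {j : S.X₂ ⟶ I} [Mono j] {a : S.X₃ ⟶ E} {b : I ⟶ E} (sq : IsPushout S.g j a b) :
    ∃ w : (S.f ≫ j) ≫ b = 0, (ShortComplex.mk (S.f ≫ j) b w).ShortExact := by
  have := hS.mono_f
  have := hS.epi_g
  have hg := hS.gIsCokernel
  have w : (S.f ≫ j) ≫ b = 0 := by rw [Category.assoc, ← sq.w]; simp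
  refine ⟨w, ?_⟩
  have hx' {T : A} (x : I ⟶ T) (hx : (S.f ≫ j) ≫ x = 0) : S.f ≫ j ≫ x = 0 := by
    simpa using hx
  have he : Epi b := ⟨fun x y h => sq.hom_ext
    (by rw [← cancel_epi S.g, ← Category.assoc, sq.w, Category.assoc, h, ← Category.assoc, ← sq.w,
      Category.assoc]) h⟩
  have key : IsColimit (CokernelCofork.ofπ b w) :=
    CokernelCofork.IsColimit.ofπ' _ _ (fun {T} x hx =>
      ⟨sq.desc (CokernelCofork.IsColimit.desc' hg (j ≫ x) (hx' x hx)).1 x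
        (CokernelCofork.IsColimit.desc' hg (j ≫ x) (hx' x hx)).2, sq.inr_desc _ _ _⟩)
  exact { exact := ShortComplex.exact_of_g_is_cokernel _ key
          mono_f := mono_comp S.f j
          epi_g := he }

lemma exists_factor_of_shortExact {S : ShortComplex A} (hS : S.ShortExact) {T : A} (f : S.X₂ ⟶ T)
    (h : S.f ≫ f = 0) : ∃ g : S.X₃ ⟶ T, S.g ≫ g = f := by
  have := hS.epi_g
  exact ⟨_, (CokernelCofork.IsColimit.desc' hS.gIsCokernel f h).2⟩

lemma exists_factor_of_shortExact' {S : ShortComplex A} (hS : S.ShortExact) {T : A} (f : T ⟶ S.X₂)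
    (h : f ≫ S.g = 0) : ∃ g : T ⟶ S.X₁, g ≫ S.f = f := by
  have := hS.mono_f
  exact ⟨_, (KernelFork.IsLimit.lift' hS.fIsKernel f h).2⟩

lemma shortExact_kernel {X Y : A} (p : X ⟶ Y) [Epi p] :
    (ShortComplex.mk (kernel.ι p) p (kernel.condition p)).ShortExact :=
  { exact := ShortComplex.exact_of_f_is_kernel _ (kernelIsKernel p) }

lemma shortExact_cokernel {X Y : A} (i : X ⟶ Y) [Mono i] :
    (ShortComplex.mk i (cokernel.π i) (cokernel.condition i)).ShortExact :=
  { exact := ShortComplex.exact_of_g_is_cokernel _ (cokernelIsCokernel i) }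

/-! ## Vanishing of `Ext¹` -/

lemma ExtOneVanishes.exists_lift {X : A} {S : ShortComplex A} (hS : S.ShortExact)
    (h : ExtOneVanishes X S.X₁) (f : X ⟶ S.X₃) : ∃ g : X ⟶ S.X₂, g ≫ S.g = f := by
  let := HasExt.standard A
  have : Subsingleton (Abelian.Ext.{max u v} X S.X₁ 1) := h
  obtain ⟨x, hx⟩ := Abelian.Ext.covariant_sequence_exact₃ X hS (Abelian.Ext.mk₀ f) rfl
    (Subsingleton.elim _ _)
  obtain ⟨g, rfl⟩ := Abelian.Ext.addEquiv₀.symm.surjective x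
  refine ⟨g, Abelian.Ext.addEquiv₀.symm.injective ?_⟩
  simpa using hx

lemma ExtOneVanishes.exists_extend {Y : A} {S : ShortComplex A} (hS : S.ShortExact)
    (h : ExtOneVanishes S.X₃ Y) (f : S.X₁ ⟶ Y) : ∃ g : S.X₂ ⟶ Y, S.f ≫ g = f := by
  let := HasExt.standard A
  have : Subsingleton (Abelian.Ext.{max u v} S.X₃ Y 1) := h
  obtain ⟨x, hx⟩ := Abelian.Ext.contravariant_sequence_exact₁ hS Y (Abelian.Ext.mk₀ f) rfl
    (Subsingleton.elim _ _)
  obtain ⟨g, rfl⟩ := Abelian.Ext.addEquiv₀.symm.surjective x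
  refine ⟨g, Abelian.Ext.addEquiv₀.symm.injective ?_⟩
  simpa using hx

/-- Since `Ext¹` into an injective object is zero, every class in `Ext¹(X, S.X₁)` is the image of a
morphism `X ⟶ S.X₃` under the connecting map, and this image is zero once the morphism lifts to
`S.X₂`. -/
lemma extOneVanishes_of_forall_lift {X : A} {S : ShortComplex A} (hS : S.ShortExact)
    [Injective S.X₂] (h : ∀ f : X ⟶ S.X₃, ∃ g : X ⟶ S.X₂, g ≫ S.g = f) :
    ExtOneVanishes X S.X₁ := by
  let := HasExt.standard A
  refine subsingleton_of_forall_eq 0 fun e => ?_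
  obtain ⟨x, rfl⟩ := Abelian.Ext.covariant_sequence_exact₁ X hS e
    (Abelian.Ext.eq_zero_of_injective _) (zero_add 1)
  obtain ⟨f, rfl⟩ := Abelian.Ext.addEquiv₀.symm.surjective x
  obtain ⟨g, rfl⟩ := h f
  simp [← Abelian.Ext.mk₀_comp_mk₀, Abelian.Ext.comp_assoc_of_second_deg_zero]

lemma extOneVanishes_of_forall_extend {Y : A} {S : ShortComplex A} (hS : S.ShortExact)
    [Projective S.X₂] (h : ∀ f : S.X₁ ⟶ Y, ∃ g : S.X₂ ⟶ Y, S.f ≫ g = f) :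
    ExtOneVanishes S.X₃ Y := by
  let := HasExt.standard A
  refine subsingleton_of_forall_eq 0 fun e => ?_
  obtain ⟨x, rfl⟩ := Abelian.Ext.contravariant_sequence_exact₃ hS Y e
    (Abelian.Ext.eq_zero_of_projective _) (add_zero 1)
  obtain ⟨f, rfl⟩ := Abelian.Ext.addEquiv₀.symm.surjective x
  obtain ⟨g, rfl⟩ := h f
  simp [← Abelian.Ext.mk₀_comp_mk₀]

section Frobenius

variable [IsFrobenius A]

/-- The middle term is also projective, so lifting to it and being stably zero are the same
condition on a morphism to `S.X₃`. -/
lemma extOneVanishes_iff_of_injective {X : A} {S : ShortComplex A} (hS : S.ShortExact)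
    [Injective S.X₂] :
    ExtOneVanishes X S.X₁ ↔ ∀ f : X ⟶ S.X₃, FactorsThruProjective f := by
  have := hS.epi_g
  have := projective_of_injective S.X₂
  refine ⟨fun h f => ?_, fun h => extOneVanishes_of_forall_lift hS fun f => ?_⟩
  · obtain ⟨g, hg⟩ := h.exists_lift hS f
    exact ⟨S.X₂, inferInstance, g, S.g, hg⟩
  · obtain ⟨g, -, hg⟩ := (h f).exists_lift S.g
    exact ⟨g, hg⟩

lemma extOneVanishes_iff_of_projective {Y : A} {S : ShortComplex A} (hS : S.ShortExact)
    [Projective S.X₂] :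
    ExtOneVanishes S.X₃ Y ↔ ∀ f : S.X₁ ⟶ Y, FactorsThruProjective f := by
  have := hS.mono_f
  refine ⟨fun h f => ?_, fun h => extOneVanishes_of_forall_extend hS fun f => ?_⟩
  · obtain ⟨g, hg⟩ := h.exists_extend hS f
    exact ⟨S.X₂, inferInstance, S.f, g, hg⟩
  · obtain ⟨g, -, hg⟩ := (h f).exists_extend S.f
    exact ⟨g, hg⟩

lemma shortExact_cosyzygy (X : A) :
    (ShortComplex.mk (Injective.ι X) (cokernel.π _) (cokernel.condition _)).ShortExact :=
  shortExact_cokernel _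

lemma shortExact_syzygy (X : A) :
    (ShortComplex.mk (kernel.ι (Projective.π X)) (Projective.π X)
      (kernel.condition _)).ShortExact :=
  shortExact_kernel _

/-- `Ext¹(X, Y)` is the group of stable morphisms from `X` to `ΣY`. -/
lemma extOneVanishes_iff_cosyzygy {X Y : A} :
    ExtOneVanishes X Y ↔ ∀ f : X ⟶ cosyzygy Y, FactorsThruProjective f :=
  extOneVanishes_iff_of_injective (shortExact_cosyzygy Y)

/-- `Ext¹(X, Y)` is the group of stable morphisms from `ΩX` to `Y`. -/
lemma extOneVanishes_iff_syzygy {X Y : A} :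
    ExtOneVanishes X Y ↔ ∀ f : syzygy X ⟶ Y, FactorsThruProjective f :=
  extOneVanishes_iff_of_projective (shortExact_syzygy X)

lemma extOneVanishes_cosyzygy_iff {X Y : A} :
    ExtOneVanishes (cosyzygy X) Y ↔ ∀ f : X ⟶ Y, FactorsThruProjective f := by
  have : Projective (ShortComplex.mk (Injective.ι X) (cokernel.π (Injective.ι X))
    (cokernel.condition _)).X₂ := projective_of_injective (Injective.under X)
  exact extOneVanishes_iff_of_projective (shortExact_cosyzygy X)

lemma extOneVanishes_syzygy_iff {X Y : A} :
    ExtOneVanishes X (syzygy Y) ↔ ∀ f : X ⟶ Y, FactorsThruProjective f := by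
  have : Injective (ShortComplex.mk (kernel.ι (Projective.π Y)) (Projective.π Y)
    (kernel.condition _)).X₂ := injective_of_projective (Projective.over Y)
  exact extOneVanishes_iff_of_injective (shortExact_syzygy Y)

end Frobenius

end

section

variable {A : Type u} [Category.{v} A] [Abelian A]

/-! ## Coreflections and reflections in the stable category -/

/-- The splitting of idempotents in the stable category, expressed by morphisms of `A`. -/
lemma exists_stable_splitting [IsIdempotentComplete (StableCategory A)] {D : A} (e : D ⟶ D)
    (he : FactorsThruProjective (e ≫ e - e)) :
    ∃ (U : A) (s : U ⟶ D) (r : D ⟶ U), FactorsThruProjective (s ≫ r - 𝟙 U) ∧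
      FactorsThruProjective (r ≫ s - e) := by
  have h := (toStable_map_eq_iff _ _).2 he
  rw [(toStable A).map_comp] at h
  obtain ⟨⟨U⟩, i, p, hip, hpi⟩ := IsIdempotentComplete.idempotents_split _ _ h
  obtain ⟨s, rfl⟩ := exists_toStable_map_eq (X := U) i
  obtain ⟨r, rfl⟩ := exists_toStable_map_eq (Y := U) p
  refine ⟨U, s, r, (toStable_map_eq_iff _ _).1 ?_, (toStable_map_eq_iff _ _).1 ?_⟩
  · rw [(toStable A).map_comp, (toStable A).map_id]
    exact hip
  · rw [(toStable A).map_comp]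
    exact hpi

variable {X : ObjectProperty A}

lemma shortExact_biprod (M N : A) :
    (ShortComplex.mk (biprod.inl : M ⟶ M ⊞ N) biprod.snd (by simp)).ShortExact :=
  (ShortComplex.Splitting.ofHasBinaryBiproduct M N).shortExact

lemma prop_biprod (h : ∀ S : ShortComplex A, S.ShortExact → X S.X₁ → X S.X₃ → X S.X₂)
    {M N : A} (hM : X M) (hN : X N) : X (M ⊞ N) :=
  h _ (shortExact_biprod M N) hM hN

section Frobenius

variable [IsFrobenius A]

lemma IsCoresolving.projective (hX : IsCoresolving X) (P : A) [Projective P] : X P :=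
  hX.injective P (injective_of_projective P)

lemma IsResolving.injective (hX : IsResolving X) (I : A) [Injective I] : X I :=
  hX.projective I (projective_of_injective I)

/-- Adding a projective summand makes a precover epi without leaving `X`, because projective objects
are injective. -/
lemma IsPrecovering.exists_epi (h : IsPrecovering X) (hX : IsCoresolving X) (M : A) :
    ∃ (C : A) (p : C ⟶ M), X C ∧ Epi p ∧ ∀ (D : A) (f : D ⟶ M), X D → ∃ g : D ⟶ C, g ≫ p = f := by
  obtain ⟨C, p, hC, hp⟩ := h M
  refine ⟨C ⊞ Projective.over M, biprod.desc p (Projective.π M),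
    prop_biprod hX.extension hC (hX.projective _), ?_, fun D f hD => ?_⟩
  · exact epi_of_epi_fac (biprod.inr_desc p (Projective.π M))
  · obtain ⟨g, hg⟩ := hp D f hD
    exact ⟨g ≫ biprod.inl, by simp [hg]⟩

lemma IsPreenveloping.exists_mono (h : IsPreenveloping X) (hX : IsResolving X) (M : A) :
    ∃ (C : A) (j : M ⟶ C), X C ∧ Mono j ∧ ∀ (D : A) (f : M ⟶ D), X D → ∃ g : C ⟶ D, j ≫ g = f := by
  obtain ⟨C, j, hC, hj⟩ := h M
  refine ⟨C ⊞ Injective.under M, biprod.lift j (Injective.ι M),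
    prop_biprod hX.extension hC (hX.injective _), ?_, fun D f hD => ?_⟩
  · exact mono_of_mono_fac (biprod.lift_snd j (Injective.ι M))
  · obtain ⟨g, hg⟩ := hj D f hD
    exact ⟨biprod.fst ≫ g, by simp [hg]⟩

variable [IsIdempotentComplete (StableCategory A)]

/-- A precovering coresolving subcategory closed under direct summands is coreflective in the
stable category. -/
lemma exists_stable_coreflection (hp : IsPrecovering X) (hX : IsCoresolving X)
    (hr : X.IsStableUnderRetracts) (M : A) :
    ∃ (U : A) (q : U ⟶ M), X U ∧ Epi q ∧ (∀ (D : A) (f : D ⟶ M), X D → ∃ g : D ⟶ U, g ≫ q = f) ∧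
      ∀ (D : A) (f : D ⟶ U), X D → FactorsThruProjective (f ≫ q) → FactorsThruProjective f := by
  obtain ⟨C₀, p₀, hC₀, _, hp₀⟩ := hp.exists_epi hX M
  obtain ⟨C₁, p₁, hC₁, _, hp₁⟩ := hp.exists_epi hX (kernel p₀)
  -- The injective component only serves to make `m` a monomorphism. Stably, `D` is the cone of `C₁
  -- ⟶ C₀`.
  let m : C₁ ⟶ C₀ ⊞ Injective.under C₁ := biprod.lift (p₁ ≫ kernel.ι p₀) (Injective.ι C₁)
  have hm : Mono m := mono_of_mono_fac (biprod.lift_snd _ _)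
  let D := cokernel m
  have hD : X D := hX.cokernel _ (shortExact_cokernel m) hC₁
    (prop_biprod hX.extension hC₀ (hX.injective _ inferInstance))
  let c : C₀ ⟶ D := biprod.inl ≫ cokernel.π m
  let q : D ⟶ M := cokernel.desc m (biprod.desc p₀ 0) (by simp [m])
  have hcq : c ≫ q = p₀ := by simp [c, q]
  obtain ⟨t, ht⟩ := hp₀ D q hD
  -- Modulo the image of `m`, this composite is minus a morphism through the injective object
  -- `Injective.under C₁`.
  have hdc : FactorsThruProjective ((p₁ ≫ kernel.ι p₀) ≫ c) := by
    have e : m = (p₁ ≫ kernel.ι p₀) ≫ biprod.inl + Injective.ι C₁ ≫ biprod.inr := by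
      ext <;> simp [m]
    have e' : (p₁ ≫ kernel.ι p₀) ≫ c = -(Injective.ι C₁ ≫ biprod.inr ≫ cokernel.π m) := by
      have h := (congrArg (· ≫ cokernel.π m) e).symm.trans (cokernel.condition m)
      simp only [Preadditive.add_comp, Category.assoc] at h
      simpa only [c, Category.assoc] using eq_neg_of_add_eq_zero_left h
    rw [e']
    exact FactorsThruProjective.neg ⟨_, projective_of_injective _, _, _, rfl⟩
  -- Here `f ≫ t` lands in the kernel of `p₀`, so it factors through `C₁`, and `c` stably kills what
  -- comes from `C₁`.
  have key (T : A) (hT : X T) (f : T ⟶ D) (hf : f ≫ q = 0) :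
      FactorsThruProjective (f ≫ t ≫ c) := by
    obtain ⟨h, hh⟩ := hp₁ T (kernel.lift p₀ (f ≫ t) (by rw [Category.assoc, ht, hf])) hT
    have : f ≫ t ≫ c = h ≫ (p₁ ≫ kernel.ι p₀) ≫ c := by simp [reassoc_of% hh]
    rw [this]
    exact hdc.precomp h
  have key' (T : A) (hT : X T) (f : T ⟶ D) (hf : FactorsThruProjective (f ≫ q)) :
      FactorsThruProjective (f ≫ t ≫ c) := by
    obtain ⟨g, hg, hgp⟩ := hf.exists_lift p₀
    have h := (key T hT (f - g ≫ c) (by simp [hcq, hgp])).add (hg.postcomp (c ≫ t ≫ c))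
    simpa using h
  have heq : (t ≫ c) ≫ q = q := by rw [Category.assoc, hcq, ht]
  -- Apply `key` to `𝟙 D - t ≫ c`, which `q` kills.
  have he : FactorsThruProjective ((t ≫ c) ≫ (t ≫ c) - t ≫ c) := by
    have h := (key D hD (𝟙 D - t ≫ c) (by rw [Preadditive.sub_comp, heq]; simp)).neg
    simpa using h
  obtain ⟨U, s, r, hsr, hrs⟩ := exists_stable_splitting (t ≫ c) he
  obtain ⟨P, hP, ⟨ret⟩⟩ := exists_retract_biprod hsr
  have hU : X U := hr.of_retract ret (prop_biprod hX.extension hD (hX.projective P))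
  -- The projective summand makes the morphism epi and absorbs the stably zero error in the
  -- factorizations through `U`.
  refine ⟨U ⊞ Projective.over M, biprod.desc (s ≫ q) (Projective.π M),
    prop_biprod hX.extension hU (hX.projective _),
    epi_of_epi_fac (biprod.inr_desc _ _), fun T f hT => ?_, fun T f hT hf => ?_⟩
  · obtain ⟨g, hg⟩ := hp₀ T f hT
    have h : f - (g ≫ c ≫ r) ≫ s ≫ q = -((g ≫ c) ≫ (r ≫ s - t ≫ c) ≫ q) := by
      simp only [Preadditive.comp_sub, Preadditive.sub_comp, Category.assoc, hcq, ht, hg]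
      abel
    have h' : FactorsThruProjective (f - (g ≫ c ≫ r) ≫ s ≫ q) := by
      rw [h]
      exact ((hrs.postcomp q).precomp (g ≫ c)).neg
    obtain ⟨k, -, hk⟩ := h'.exists_lift (Projective.π M)
    exact ⟨biprod.lift (g ≫ c ≫ r) k, by rw [biprod.lift_desc, hk]; abel⟩
  · have h₁ : FactorsThruProjective (f ≫ biprod.snd) := .of_projective_target _
    have e : f ≫ biprod.desc (s ≫ q) (Projective.π M) =
        (f ≫ biprod.fst) ≫ s ≫ q + (f ≫ biprod.snd) ≫ Projective.π M := by
      rw [biprod.desc_eq]; simp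
    rw [e] at hf
    have h₂ := hf.sub (h₁.postcomp (Projective.π M))
    rw [add_sub_cancel_right, ← Category.assoc] at h₂
    have h₃ := (toStable_map_eq_zero_iff _).2 (key' T hT _ h₂)
    have hsr' := (toStable_map_eq_iff _ _).2 hsr
    have hrs' := (toStable_map_eq_iff _ _).2 hrs
    have h₀ : FactorsThruProjective (f ≫ biprod.fst) := by
      rw [← toStable_map_eq_zero_iff]
      simp only [(toStable A).map_comp, (toStable A).map_id, Category.assoc] at h₃ hsr' hrs' ⊢
      rw [← hrs', reassoc_of% hsr'] at h₃
      have := congrArg (· ≫ (toStable A).map r) h₃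
      simpa [hsr'] using this
    have h := (h₀.postcomp biprod.inl).add (h₁.postcomp biprod.inr)
    have e' : (f ≫ biprod.fst) ≫ biprod.inl + (f ≫ biprod.snd) ≫ biprod.inr = f := by
      ext <;> simp
    rwa [e'] at h

/-- A preenveloping resolving subcategory closed under direct summands is reflective in the
stable category. -/
lemma exists_stable_reflection (hp : IsPreenveloping X) (hX : IsResolving X)
    (hr : X.IsStableUnderRetracts) (M : A) :
    ∃ (U : A) (q : M ⟶ U), X U ∧ Mono q ∧ (∀ (D : A) (f : M ⟶ D), X D → ∃ g : U ⟶ D, q ≫ g = f) ∧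
      ∀ (D : A) (f : U ⟶ D), X D → FactorsThruProjective (q ≫ f) → FactorsThruProjective f := by
  obtain ⟨C₀, p₀, hC₀, _, hp₀⟩ := hp.exists_mono hX M
  obtain ⟨C₁, p₁, hC₁, _, hp₁⟩ := hp.exists_mono hX (cokernel p₀)
  -- The construction is dual: stably, `D` is the fibre of `C₀ ⟶ C₁`, and the projective summand
  -- makes `m` epi.
  let m : C₀ ⊞ Projective.over C₁ ⟶ C₁ := biprod.desc (cokernel.π p₀ ≫ p₁) (Projective.π C₁)
  have hm : Epi m := epi_of_epi_fac (biprod.inr_desc _ _)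
  let D := kernel m
  have hD : X D := hX.kernel _ (shortExact_kernel m)
    (prop_biprod hX.extension hC₀ (hX.projective _ inferInstance)) hC₁
  let c : D ⟶ C₀ := kernel.ι m ≫ biprod.fst
  let q : M ⟶ D := kernel.lift m (biprod.lift p₀ 0) (by simp [m])
  have hcq : q ≫ c = p₀ := by simp [c, q]
  obtain ⟨t, ht⟩ := hp₀ D q hD
  have hdc : FactorsThruProjective (c ≫ cokernel.π p₀ ≫ p₁) := by
    have e : m = biprod.fst ≫ (cokernel.π p₀ ≫ p₁) + biprod.snd ≫ Projective.π C₁ := by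
      ext <;> simp [m]
    have e' : c ≫ cokernel.π p₀ ≫ p₁ = -((kernel.ι m ≫ biprod.snd) ≫ Projective.π C₁) := by
      have h := (congrArg (kernel.ι m ≫ ·) e).symm.trans (kernel.condition m)
      rw [Preadditive.comp_add, ← Category.assoc, ← Category.assoc (kernel.ι m) biprod.snd] at h
      exact eq_neg_of_add_eq_zero_left h
    rw [e']
    exact FactorsThruProjective.neg ⟨_, inferInstance, _, _, rfl⟩
  have key (T : A) (hT : X T) (f : D ⟶ T) (hf : q ≫ f = 0) :
      FactorsThruProjective (c ≫ t ≫ f) := by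
    obtain ⟨h, hh⟩ := hp₁ T (cokernel.desc p₀ (t ≫ f) (by rw [← Category.assoc, ht, hf])) hT
    have : c ≫ t ≫ f = (c ≫ cokernel.π p₀ ≫ p₁) ≫ h := by simp [hh]
    rw [this]
    exact hdc.postcomp h
  have key' (T : A) (hT : X T) (f : D ⟶ T) (hf : FactorsThruProjective (q ≫ f)) :
      FactorsThruProjective (c ≫ t ≫ f) := by
    obtain ⟨g, hg, hgp⟩ := hf.exists_extend p₀
    have h := (key T hT (f - c ≫ g) (by simp [reassoc_of% hcq, hgp])).add (hg.precomp (c ≫ t ≫ c))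
    simpa using h
  have heq : q ≫ c ≫ t = q := by rw [← Category.assoc, hcq, ht]
  have he : FactorsThruProjective ((c ≫ t) ≫ (c ≫ t) - c ≫ t) := by
    have h := (key D hD (𝟙 D - c ≫ t) (by rw [Preadditive.comp_sub, heq]; simp)).neg
    simpa using h
  obtain ⟨U, s, r, hsr, hrs⟩ := exists_stable_splitting (c ≫ t) he
  obtain ⟨P, hP, ⟨ret⟩⟩ := exists_retract_biprod hsr
  have hU : X U := hr.of_retract ret (prop_biprod hX.extension hD (hX.projective P inferInstance))
  refine ⟨U ⊞ Injective.under M, biprod.lift (q ≫ r) (Injective.ι M),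
    prop_biprod hX.extension hU (hX.injective _),
    mono_of_mono_fac (biprod.lift_snd _ _), fun T f hT => ?_, fun T f hT hf => ?_⟩
  · obtain ⟨g, hg⟩ := hp₀ T f hT
    have h : f - (q ≫ r) ≫ (s ≫ c ≫ g) = -(q ≫ (r ≫ s - c ≫ t) ≫ c ≫ g) := by
      simp only [Preadditive.comp_sub, Preadditive.sub_comp, Category.assoc, reassoc_of% hcq,
        reassoc_of% ht, hg]
      abel
    have h' : FactorsThruProjective (f - (q ≫ r) ≫ (s ≫ c ≫ g)) := by
      rw [h]
      exact ((hrs.postcomp (c ≫ g)).precomp q).neg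
    obtain ⟨k, -, hk⟩ := h'.exists_extend (Injective.ι M)
    exact ⟨biprod.desc (s ≫ c ≫ g) k, by rw [biprod.lift_desc, hk]; abel⟩
  · have : Projective (Injective.under M) := projective_of_injective _
    have h₁ : FactorsThruProjective (biprod.inr ≫ f) := .of_projective_source _
    have e : biprod.lift (q ≫ r) (Injective.ι M) ≫ f =
        q ≫ r ≫ biprod.inl ≫ f + Injective.ι M ≫ biprod.inr ≫ f := by
      rw [biprod.lift_eq]; simp
    rw [e] at hf
    have h₂ := hf.sub (h₁.precomp (Injective.ι M))
    rw [add_sub_cancel_right] at h₂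
    have h₃ := (toStable_map_eq_zero_iff _).2 (key' T hT _ h₂)
    have hsr' := (toStable_map_eq_iff _ _).2 hsr
    have hrs' := (toStable_map_eq_iff _ _).2 hrs
    have h₀ : FactorsThruProjective (biprod.inl ≫ f) := by
      rw [← toStable_map_eq_zero_iff]
      simp only [(toStable A).map_comp, (toStable A).map_id] at h₃ hsr' hrs' ⊢
      rw [← reassoc_of% hrs', reassoc_of% hsr'] at h₃
      have := congrArg ((toStable A).map s ≫ ·) h₃
      simpa [reassoc_of% hsr'] using this
    have h := (h₀.precomp biprod.fst).add (h₁.precomp biprod.snd)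
    have e' : biprod.fst ≫ biprod.inl ≫ f + biprod.snd ≫ biprod.inr ≫ f = f := by
      ext <;> simp
    rwa [e'] at h

end Frobenius

end

section

variable {A : Type u} [Category.{v} A] [Abelian A]

/-! ## Orthogonal classes in the stable category -/

/-- A class of objects is closed under the retracts of the stable category. -/
def IsStableUnderStableRetracts (X : ObjectProperty A) : Prop :=
  ∀ ⦃M N : A⦄ (f : M ⟶ N) (g : N ⟶ M), FactorsThruProjective (f ≫ g - 𝟙 M) → X N → X M

/-- The objects without nonzero stable morphisms to the objects of `V`. -/
def stableLeftPerp (V : ObjectProperty A) : ObjectProperty A :=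
  fun M => ∀ N, V N → ∀ f : M ⟶ N, FactorsThruProjective f

/-- The objects without nonzero stable morphisms from the objects of `U`. -/
def stableRightPerp (U : ObjectProperty A) : ObjectProperty A :=
  fun N => ∀ M, U M → ∀ f : M ⟶ N, FactorsThruProjective f

lemma isStableUnderStableRetracts_stableLeftPerp (V : ObjectProperty A) :
    IsStableUnderStableRetracts (stableLeftPerp V) := fun M N f g h hN T hT k => by
  have := ((hN T hT (g ≫ k)).precomp f).sub (h.postcomp k)
  simpa using this

lemma isStableUnderStableRetracts_stableRightPerp (U : ObjectProperty A) :
    IsStableUnderStableRetracts (stableRightPerp U) := fun M N f g h hN T hT k => by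
  have := ((hN T hT (k ≫ f)).postcomp g).sub (h.precomp k)
  simpa using this

namespace IsStableUnderStableRetracts

variable {X : ObjectProperty A} (hX : IsStableUnderStableRetracts X)
include hX

lemma isStableUnderRetracts : X.IsStableUnderRetracts where
  of_retract r hN := hX r.i r.r (by simpa using FactorsThruProjective.zero _ _) hN

lemma prop_of_iso {M N : A} (e : (toStable A).obj M ≅ (toStable A).obj N) (hN : X N) : X M := by
  obtain ⟨f, hf⟩ := exists_toStable_map_eq e.hom
  obtain ⟨g, hg⟩ := exists_toStable_map_eq e.inv
  refine hX f g ((toStable_map_eq_iff _ _).1 ?_) hN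
  rw [(toStable A).map_comp, hf, hg, e.hom_inv_id, (toStable A).map_id]

lemma stableImage_iff (M : A) : stableImage X ((toStable A).obj M) ↔ X M := by
  refine ⟨fun ⟨N, hN, ⟨e⟩⟩ => hX.prop_of_iso e.symm hN, fun h => X.prop_map_obj _ h⟩

lemma eq_of_stableImage_eq {X' : ObjectProperty A}
    (hX' : IsStableUnderStableRetracts X')
    (h : stableImage X = stableImage X') : X = X' := by
  ext M
  rw [← hX.stableImage_iff, ← hX'.stableImage_iff, h]

variable [IsFrobenius A]

lemma isSuspensionClosed_iff : IsSuspensionClosed X ↔ ∀ M, X M → X (cosyzygy M) :=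
  ⟨fun h M hM => (hX.stableImage_iff _).1 (h _ ((hX.stableImage_iff M).2 hM)),
    fun h M hM => (hX.stableImage_iff (cosyzygy M.as)).2 (h _ ((hX.stableImage_iff M.as).1 hM))⟩

lemma isLoopClosed_iff : IsLoopClosed X ↔ ∀ M, X M → X (syzygy M) :=
  ⟨fun h M hM => (hX.stableImage_iff _).1 (h _ ((hX.stableImage_iff M).2 hM)),
    fun h M hM => (hX.stableImage_iff (syzygy M.as)).2 (h _ ((hX.stableImage_iff M.as).1 hM))⟩

end IsStableUnderStableRetracts

section Frobenius

variable [IsFrobenius A]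

lemma stableLeftPerp_extension {V : ObjectProperty A} {S : ShortComplex A} (hS : S.ShortExact)
    (h₁ : stableLeftPerp V S.X₁) (h₃ : stableLeftPerp V S.X₃) : stableLeftPerp V S.X₂ := by
  intro T hT f
  have := hS.mono_f
  obtain ⟨g, hg, hgf⟩ := (h₁ T hT (S.f ≫ f)).exists_extend S.f
  obtain ⟨k, hk⟩ := exists_factor_of_shortExact hS (f - g) (by simp [hgf])
  have := ((h₃ T hT k).precomp S.g).add hg
  rwa [hk, sub_add_cancel] at this

lemma stableRightPerp_extension {U : ObjectProperty A} {S : ShortComplex A} (hS : S.ShortExact)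
    (h₁ : stableRightPerp U S.X₁) (h₃ : stableRightPerp U S.X₃) : stableRightPerp U S.X₂ := by
  intro T hT f
  have := hS.epi_g
  obtain ⟨g, hg, hgf⟩ := (h₃ T hT (f ≫ S.g)).exists_lift S.g
  obtain ⟨k, hk⟩ := exists_factor_of_shortExact' hS (f - g) (by simp [hgf])
  have := ((h₁ T hT k).postcomp S.f).add hg
  rwa [hk, sub_add_cancel] at this

/-- For cokernels, push out `S.f` along the embedding of `S.X₁` into an injective object. The
pushout is an extension of `cosyzygy S.X₁` by `S.X₂`, so it lies in the class. It is also an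
extension of `S.X₃` by an injective object, which splits, so `S.X₃` is a summand of it. -/
lemma isCoresolving_stableLeftPerp {V : ObjectProperty A}
    (h : ∀ M, stableLeftPerp V M → stableLeftPerp V (cosyzygy M)) :
    IsCoresolving (stableLeftPerp V) where
  injective I hI := fun N _ f => by
    have := projective_of_injective I
    exact .of_projective_source f
  extension _ hS h₁ h₃ := stableLeftPerp_extension hS h₁ h₃
  cokernel S hS h₁ h₂ := by
    have hI := shortExact_cosyzygy S.X₁
    have sq : IsPushout S.f (Injective.ι S.X₁) (pushout.inl _ _) (pushout.inr _ _) :=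
      IsPushout.of_hasPushout _ _
    obtain ⟨p, w, -, hp⟩ := exists_shortExact_of_isPushout hI sq
    obtain ⟨p', w', -, hp'⟩ := exists_shortExact_of_isPushout hS sq.flip
    have hE : stableLeftPerp V (pushout S.f (Injective.ι S.X₁)) :=
      stableLeftPerp_extension hp h₂ (h _ h₁)
    have hm := hp'.mono_f
    dsimp only at hm
    obtain ⟨k, hk⟩ := exists_factor_of_shortExact hp'
      (𝟙 _ - Injective.factorThru (𝟙 _) (pushout.inr S.f (Injective.ι S.X₁)) ≫ pushout.inr _ _)
      (by simp)
    dsimp only at k hk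
    have he := hp'.epi_g
    dsimp only at he
    refine (isStableUnderStableRetracts_stableLeftPerp V).isStableUnderRetracts.of_retract
      ⟨k, p', ?_⟩ hE
    rw [← cancel_epi p', reassoc_of% hk]
    simp [w']

lemma isResolving_stableRightPerp {U : ObjectProperty A}
    (h : ∀ M, stableRightPerp U M → stableRightPerp U (syzygy M)) :
    IsResolving (stableRightPerp U) where
  projective P hP := fun N _ f => .of_projective_target f
  extension _ hS h₁ h₃ := stableRightPerp_extension hS h₁ h₃
  kernel S hS h₂ h₃ := by
    have hI := shortExact_syzygy S.X₃
    have sq : IsPullback (pullback.fst _ _) (pullback.snd _ _) S.g (Projective.π S.X₃) :=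
      IsPullback.of_hasPullback _ _
    obtain ⟨p, w, -, hp⟩ := exists_shortExact_of_isPullback hI sq
    obtain ⟨p', w', -, hp'⟩ := exists_shortExact_of_isPullback hS sq.flip
    have hE : stableRightPerp U (pullback S.g (Projective.π S.X₃)) :=
      stableRightPerp_extension hp (h _ h₃) h₂
    have he := hp'.epi_g
    dsimp only at he
    obtain ⟨k, hk⟩ := exists_factor_of_shortExact' hp'
      (𝟙 _ - pullback.snd _ _ ≫ Projective.factorThru (𝟙 _) (pullback.snd S.g (Projective.π S.X₃)))
      (by simp)
    dsimp only at k hk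
    have hm := hp'.mono_f
    dsimp only at hm
    refine (isStableUnderStableRetracts_stableRightPerp U).isStableUnderRetracts.of_retract
      ⟨p', k, ?_⟩ hE
    rw [← cancel_mono p', Category.assoc, hk]
    simp [reassoc_of% w']

end Frobenius

/-! ## Special approximations -/

lemma ExtOneVanishes.middle {D : A} {S : ShortComplex A} (hS : S.ShortExact)
    (h₁ : ExtOneVanishes D S.X₁) (h₃ : ExtOneVanishes D S.X₃) : ExtOneVanishes D S.X₂ := by
  let := HasExt.standard A
  have : Subsingleton (Abelian.Ext.{max u v} D S.X₁ 1) := h₁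
  have : Subsingleton (Abelian.Ext.{max u v} D S.X₃ 1) := h₃
  refine subsingleton_of_forall_eq 0 fun e => ?_
  obtain ⟨x, rfl⟩ := Abelian.Ext.covariant_sequence_exact₂ D hS e (Subsingleton.elim _ _)
  rw [Subsingleton.elim x 0, Abelian.Ext.zero_comp]

lemma ExtOneVanishes.middle' {D : A} {S : ShortComplex A} (hS : S.ShortExact)
    (h₁ : ExtOneVanishes S.X₁ D) (h₃ : ExtOneVanishes S.X₃ D) : ExtOneVanishes S.X₂ D := by
  let := HasExt.standard A
  have : Subsingleton (Abelian.Ext.{max u v} S.X₁ D 1) := h₁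
  have : Subsingleton (Abelian.Ext.{max u v} S.X₃ D 1) := h₃
  refine subsingleton_of_forall_eq 0 fun e => ?_
  obtain ⟨x, rfl⟩ := Abelian.Ext.contravariant_sequence_exact₂ hS D e (Subsingleton.elim _ _)
  rw [Subsingleton.elim x 0, Abelian.Ext.comp_zero]

lemma extOneVanishes_injective (D I : A) [Injective I] : ExtOneVanishes D I := by
  let := HasExt.standard A
  exact Abelian.Ext.subsingleton_of_injective D I 0

lemma extOneVanishes_projective (P D : A) [Projective P] : ExtOneVanishes P D := by
  let := HasExt.standard A
  exact subsingleton_of_forall_eq 0 Abelian.Ext.eq_zero_of_projective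

variable [IsFrobenius A] {X : ObjectProperty A}

/-- The kernel of a stable coreflection onto a class closed under extensions is right orthogonal
to the class. -/
lemma extOneVanishes_of_stable_coreflection
    (hX : ∀ S : ShortComplex A, S.ShortExact → X S.X₁ → X S.X₃ → X S.X₂)
    {S : ShortComplex A} (hS : S.ShortExact) (hU : X S.X₂)
    (hq : ∀ (D : A) (f : D ⟶ S.X₃), X D → ∃ g : D ⟶ S.X₂, g ≫ S.g = f)
    (hq' : ∀ (D : A) (f : D ⟶ S.X₂), X D → FactorsThruProjective (f ≫ S.g) →
      FactorsThruProjective f) {D : A} (hD : X D) : ExtOneVanishes D S.X₁ := by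
  have hK := shortExact_syzygy D
  refine extOneVanishes_of_forall_extend hK fun f => ?_
  dsimp only at f ⊢
  have := hS.mono_f
  -- `E` is an extension of `D` by `S.X₂`, hence in the class. The morphism `E ⟶ S.X₃` given by
  -- `S.g` on `S.X₂` and by zero on the projective object can thus be lifted to `S.X₂`.
  obtain ⟨E, inl, inr, sq⟩ : ∃ (E : A) (inl : S.X₂ ⟶ E) (inr : Projective.over D ⟶ E),
    IsPushout (f ≫ S.f) (kernel.ι (Projective.π D)) inl inr :=
    ⟨_, _, _, IsPushout.of_hasPushout _ _⟩
  obtain ⟨p, w, hp, hW⟩ := exists_shortExact_of_isPushout hK sq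
  have hm := hW.mono_f
  dsimp only at p w hp hm
  obtain ⟨k, hk⟩ := hq _ (sq.desc S.g 0 (by simp)) (hX _ hW hU hD)
  -- The lift `k` retracts `inl` only up to a morphism killed by `S.g`, which is stably zero by
  -- `hq'`. Subtracting an extension `z` of it makes the retraction exact.
  obtain ⟨z, hz, hz'⟩ := (hq' S.X₂ (inl ≫ k - 𝟙 _) hU (by
    rw [Preadditive.sub_comp, Category.assoc, hk, sq.inl_desc, Category.id_comp, sub_self]
    exact .zero _ _)).exists_extend inl
  have hkz : inl ≫ (k - z) = 𝟙 _ := by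
    rw [Preadditive.comp_sub, hz']
    simp
  have hβ : kernel.ι (Projective.π D) ≫ inr ≫ (k - z) = f ≫ S.f := by
    rw [← reassoc_of% sq.w, hkz, Category.comp_id]
  -- After this correction, the map from the projective object to `S.X₃` need not vanish, but it
  -- factors through `D`. A lift of that factor to `S.X₂` is subtracted, so that the result lands in
  -- `S.X₁`.
  obtain ⟨h, hh⟩ := exists_factor_of_shortExact hK ((inr ≫ (k - z)) ≫ S.g) (by
    dsimp only
    rw [← Category.assoc, hβ]
    simp)
  obtain ⟨h', rfl⟩ := hq D h hD
  obtain ⟨γ, hγ⟩ := exists_factor_of_shortExact' hS (inr ≫ (k - z) - Projective.π D ≫ h') (by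
    rw [Preadditive.sub_comp, ← hh]
    simp)
  refine ⟨γ, ?_⟩
  rw [← cancel_mono S.f, Category.assoc, hγ, Preadditive.comp_sub, hβ]
  simp

/-- The cokernel of a stable reflection onto a class closed under extensions is left orthogonal
to the class. -/
lemma extOneVanishes_of_stable_reflection
    (hX : ∀ S : ShortComplex A, S.ShortExact → X S.X₁ → X S.X₃ → X S.X₂)
    {S : ShortComplex A} (hS : S.ShortExact) (hU : X S.X₂)
    (hq : ∀ (D : A) (f : S.X₁ ⟶ D), X D → ∃ g : S.X₂ ⟶ D, S.f ≫ g = f)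
    (hq' : ∀ (D : A) (f : S.X₂ ⟶ D), X D → FactorsThruProjective (S.f ≫ f) →
      FactorsThruProjective f) {D : A} (hD : X D) : ExtOneVanishes S.X₃ D := by
  have hK := shortExact_cosyzygy D
  refine extOneVanishes_of_forall_lift hK fun f => ?_
  dsimp only at f ⊢
  have := hS.epi_g
  -- Dual argument: `E` is an extension of `S.X₂` by `D`, and a section of `fst` is corrected first
  -- stably, then by a morphism extended from `S.X₁`.
  obtain ⟨E, fst, snd, sq⟩ : ∃ (E : A) (fst : E ⟶ S.X₂) (snd : E ⟶ Injective.under D),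
    IsPullback fst snd (S.g ≫ f) (cokernel.π (Injective.ι D)) :=
    ⟨_, _, _, IsPullback.of_hasPullback _ _⟩
  obtain ⟨p, w, hp, hW⟩ := exists_shortExact_of_isPullback hK sq
  have hm := hW.epi_g
  dsimp only at p w hp hm
  obtain ⟨k, hk⟩ := hq _ (sq.lift S.f 0 (by simp)) (hX _ hW hD hU)
  obtain ⟨z, hz, hz'⟩ := (hq' S.X₂ (k ≫ fst - 𝟙 _) hU (by
    rw [Preadditive.comp_sub, ← Category.assoc, hk, sq.lift_fst, Category.comp_id, sub_self]
    exact .zero _ _)).exists_lift fst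
  have hkz : (k - z) ≫ fst = 𝟙 _ := by
    rw [Preadditive.sub_comp, hz']
    simp
  have hβ : ((k - z) ≫ snd) ≫ cokernel.π (Injective.ι D) = S.g ≫ f := by
    rw [Category.assoc, ← sq.w, reassoc_of% hkz]
  obtain ⟨h, hh⟩ := exists_factor_of_shortExact' hK (S.f ≫ (k - z) ≫ snd) (by
    dsimp only
    rw [Category.assoc, hβ]
    simp)
  obtain ⟨h', rfl⟩ := hq D h hD
  obtain ⟨γ, hγ⟩ := exists_factor_of_shortExact hS ((k - z) ≫ snd - h' ≫ Injective.ι D) (by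
    rw [Preadditive.comp_sub, ← hh]
    simp)
  refine ⟨γ, ?_⟩
  rw [← cancel_epi S.g, ← Category.assoc, hγ, Preadditive.sub_comp, hβ]
  simp

end

section

variable {A : Type u} [Category.{v} A] [Abelian A] [IsFrobenius A]

/-! ## Cotorsion pairs -/

/-- The right orthogonal class for `Ext¹`. -/
def extRightPerp (Z : ObjectProperty A) : ObjectProperty A :=
  fun Y => ∀ X, Z X → ExtOneVanishes X Y

/-- The left orthogonal class for `Ext¹`. -/
def extLeftPerp (W : ObjectProperty A) : ObjectProperty A :=
  fun X => ∀ Y, W Y → ExtOneVanishes X Y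

lemma extLeftPerp_eq (W : ObjectProperty A) :
    extLeftPerp W = stableLeftPerp (fun C => ∃ Y, W Y ∧ C = cosyzygy Y) := by
  ext X
  refine ⟨?_, fun h Y hY => extOneVanishes_iff_cosyzygy.2 (h _ ⟨Y, hY, rfl⟩)⟩
  rintro h _ ⟨Y, hY, rfl⟩
  exact extOneVanishes_iff_cosyzygy.1 (h Y hY)

lemma extRightPerp_eq (Z : ObjectProperty A) :
    extRightPerp Z = stableRightPerp (fun C => ∃ X, Z X ∧ C = syzygy X) := by
  ext Y
  refine ⟨?_, fun h X hX => extOneVanishes_iff_syzygy.2 (h _ ⟨X, hX, rfl⟩)⟩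
  rintro h _ ⟨X, hX, rfl⟩
  exact extOneVanishes_iff_syzygy.1 (h X hX)

namespace IsCompleteCotorsionPair

variable {Z W : ObjectProperty A} (h : IsCompleteCotorsionPair Z W)
include h

lemma eq_extLeftPerp : Z = extLeftPerp W := by
  ext X
  exact h.left_perp X

lemma eq_extRightPerp : W = extRightPerp Z := by
  ext Y
  exact h.right_perp Y

lemma eq_stableLeftPerp : Z = stableLeftPerp (fun C => ∃ Y, W Y ∧ C = cosyzygy Y) :=
  h.eq_extLeftPerp.trans (extLeftPerp_eq W)

lemma eq_stableRightPerp : W = stableRightPerp (fun C => ∃ X, Z X ∧ C = syzygy X) :=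
  h.eq_extRightPerp.trans (extRightPerp_eq Z)

lemma isStableUnderStableRetracts_left : IsStableUnderStableRetracts Z := by
  rw [h.eq_stableLeftPerp]
  exact isStableUnderStableRetracts_stableLeftPerp _

lemma isStableUnderStableRetracts_right : IsStableUnderStableRetracts W := by
  rw [h.eq_stableRightPerp]
  exact isStableUnderStableRetracts_stableRightPerp _

/-- `Ext¹(ΣX, Y)` and `Ext¹(X, ΩY)` both vanish exactly when all stable morphisms `X ⟶ Y` do. -/
lemma isSuspensionClosed_iff_isLoopClosed : IsSuspensionClosed Z ↔ IsLoopClosed W := by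
  rw [h.isStableUnderStableRetracts_left.isSuspensionClosed_iff,
    h.isStableUnderStableRetracts_right.isLoopClosed_iff]
  refine ⟨fun hZ Y hY => (h.right_perp _).2 fun X hX => ?_,
    fun hW X hX => (h.left_perp _).2 fun Y hY => ?_⟩
  · rw [extOneVanishes_syzygy_iff, ← extOneVanishes_cosyzygy_iff]
    exact (h.left_perp _).1 (hZ X hX) Y hY
  · rw [extOneVanishes_cosyzygy_iff, ← extOneVanishes_syzygy_iff]
    exact (h.right_perp _).1 (hW Y hY) X hX

lemma isCoresolving (hZ : IsSuspensionClosed Z) : IsCoresolving Z := by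
  rw [h.isStableUnderStableRetracts_left.isSuspensionClosed_iff] at hZ
  rw [h.eq_stableLeftPerp] at hZ ⊢
  exact isCoresolving_stableLeftPerp hZ

lemma isResolving (hW : IsLoopClosed W) : IsResolving W := by
  rw [h.isStableUnderStableRetracts_right.isLoopClosed_iff] at hW
  rw [h.eq_stableRightPerp] at hW ⊢
  exact isResolving_stableRightPerp hW

lemma isPrecovering : IsPrecovering Z := fun M => by
  obtain ⟨Y, X, i, p, w, hX, hY, hS⟩ := h.exists_left M
  exact ⟨X, p, hX, fun D f hD => ((h.right_perp Y).1 hY D hD).exists_lift hS f⟩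

lemma isPreenveloping : IsPreenveloping W := fun M => by
  obtain ⟨Y, X, i, p, w, hX, hY, hS⟩ := h.exists_right M
  exact ⟨Y, i, hY, fun D f hD => ((h.left_perp X).1 hX D hD).exists_extend hS f⟩

end IsCompleteCotorsionPair

section

variable {X : ObjectProperty A}

lemma isSuspensionClosed_of_isCoresolving (hX : IsCoresolving X) (h : IsStableUnderStableRetracts X) :
    IsSuspensionClosed X :=
  h.isSuspensionClosed_iff.2 fun M hM => hX.cokernel _ (shortExact_cosyzygy M) hM
    (hX.injective _ inferInstance)

lemma isLoopClosed_of_isResolving (hX : IsResolving X) (h : IsStableUnderStableRetracts X) :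
    IsLoopClosed X :=
  h.isLoopClosed_iff.2 fun M hM => hX.kernel _ (shortExact_syzygy M)
    (hX.projective _ inferInstance) hM

variable [IsIdempotentComplete (StableCategory A)]

lemma exists_special_precover (hp : IsPrecovering X) (hX : IsCoresolving X)
    (hr : X.IsStableUnderRetracts) (M : A) :
    ∃ (Y U : A) (i : Y ⟶ U) (p : U ⟶ M) (w : i ≫ p = 0),
      X U ∧ extRightPerp X Y ∧ (ShortComplex.mk i p w).ShortExact := by
  obtain ⟨U, q, hU, _, hq, hq'⟩ := exists_stable_coreflection hp hX hr M
  have hS := shortExact_kernel q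
  exact ⟨_, U, kernel.ι q, q, kernel.condition q, hU, fun D hD =>
    extOneVanishes_of_stable_coreflection hX.extension hS hU hq hq' hD, hS⟩

lemma exists_special_preenvelope (hp : IsPreenveloping X) (hX : IsResolving X)
    (hr : X.IsStableUnderRetracts) (M : A) :
    ∃ (U Y : A) (i : M ⟶ U) (p : U ⟶ Y) (w : i ≫ p = 0),
      X U ∧ extLeftPerp X Y ∧ (ShortComplex.mk i p w).ShortExact := by
  obtain ⟨U, q, hU, _, hq, hq'⟩ := exists_stable_reflection hp hX hr M
  have hS := shortExact_cokernel q
  exact ⟨U, _, q, cokernel.π q, cokernel.condition q, hU, fun D hD =>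
    extOneVanishes_of_stable_reflection hX.extension hS hU hq hq' hD, hS⟩

/-- A special precover of an object left orthogonal to `extRightPerp X` splits, so the object is a
summand of an object of `X`. -/
lemma isCompleteCotorsionPair_of_precovering (hp : IsPrecovering X) (hX : IsCoresolving X)
    (hr : X.IsStableUnderRetracts) : IsCompleteCotorsionPair X (extRightPerp X) where
  right_perp _ := Iff.rfl
  left_perp T := by
    refine ⟨fun hT Y hY => hY T hT, fun hT => ?_⟩
    obtain ⟨Y, U, i, p, w, hU, hY, hS⟩ := exists_special_precover hp hX hr T
    obtain ⟨s, hs⟩ := (hT Y hY).exists_lift hS (𝟙 T)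
    exact hr.of_retract ⟨s, p, hs⟩ hU
  exists_left M := by
    obtain ⟨Y, U, i, p, w, hU, hY, hS⟩ := exists_special_precover hp hX hr M
    exact ⟨Y, U, i, p, w, hU, hY, hS⟩
  exists_right M := by
    -- Salce's trick: the pullback of a special precover of `ΣM` along the injective object over
    -- `ΣM` is an extension of `U` by `M` and of an injective object by `Y`.
    obtain ⟨Y, U, i, p, w, hU, hY, hS⟩ := exists_special_precover hp hX hr (cosyzygy M)
    have sq := IsPullback.of_hasPullback p (cokernel.π (Injective.ι M))
    obtain ⟨i', w', -, hi⟩ := exists_shortExact_of_isPullback (shortExact_cosyzygy M) sq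
    obtain ⟨j', w'', -, hj⟩ := exists_shortExact_of_isPullback hS sq.flip
    exact ⟨_, U, i', _, w', hU, fun D hD => ExtOneVanishes.middle hj (hY D hD)
      (extOneVanishes_injective _ _), hi⟩

lemma isCompleteCotorsionPair_of_preenveloping (hp : IsPreenveloping X) (hX : IsResolving X)
    (hr : X.IsStableUnderRetracts) : IsCompleteCotorsionPair (extLeftPerp X) X where
  left_perp _ := Iff.rfl
  right_perp T := by
    refine ⟨fun hT Y hY => hY T hT, fun hT => ?_⟩
    obtain ⟨U, Y, i, p, w, hU, hY, hS⟩ := exists_special_preenvelope hp hX hr T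
    obtain ⟨s, hs⟩ := (hT Y hY).exists_extend hS (𝟙 T)
    exact hr.of_retract ⟨i, s, hs⟩ hU
  exists_right M := by
    obtain ⟨U, Y, i, p, w, hU, hY, hS⟩ := exists_special_preenvelope hp hX hr M
    exact ⟨U, Y, i, p, w, hY, hU, hS⟩
  exists_left M := by
    obtain ⟨U, Y, i, p, w, hU, hY, hS⟩ := exists_special_preenvelope hp hX hr (syzygy M)
    have sq := IsPushout.of_hasPushout i (kernel.ι (Projective.π M))
    obtain ⟨i', w', -, hi⟩ := exists_shortExact_of_isPushout (shortExact_syzygy M) sq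
    obtain ⟨j', w'', -, hj⟩ := exists_shortExact_of_isPushout hS sq.flip
    exact ⟨U, _, _, i', w', fun D hD => ExtOneVanishes.middle' hj
      (extOneVanishes_projective _ _) (hY D hD), hU, hi⟩

variable (X) in
theorem precoveringCoresolving_iff :
    (IsPrecovering X ∧ IsCoresolving X ∧ X.IsStableUnderRetracts) ↔
      ∃ Y : ObjectProperty A, IsCompleteCotorsionPair X Y ∧ IsSuspensionClosed X := by
  refine ⟨fun ⟨hp, hX, hr⟩ => ?_, fun ⟨Y, h, hs⟩ => ⟨h.isPrecovering, h.isCoresolving hs,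
    h.isStableUnderStableRetracts_left.isStableUnderRetracts⟩⟩
  have h := isCompleteCotorsionPair_of_precovering hp hX hr
  exact ⟨_, h, isSuspensionClosed_of_isCoresolving hX h.isStableUnderStableRetracts_left⟩

variable (X) in
theorem preenvelopingResolving_iff :
    (IsPreenveloping X ∧ IsResolving X ∧ X.IsStableUnderRetracts) ↔
      ∃ Z : ObjectProperty A, IsCompleteCotorsionPair Z X ∧ IsLoopClosed X := by
  refine ⟨fun ⟨hp, hX, hr⟩ => ?_, fun ⟨Y, h, hs⟩ => ⟨h.isPreenveloping, h.isResolving hs,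
    h.isStableUnderStableRetracts_right.isStableUnderRetracts⟩⟩
  have h := isCompleteCotorsionPair_of_preenveloping hp hX hr
  exact ⟨_, h, isLoopClosed_of_isResolving hX h.isStableUnderStableRetracts_right⟩

end

end

section

variable {A : Type u} [Category.{v} A] [Abelian A] [IsFrobenius A]

/-! ## Cones -/

lemma shortExact_cone {X Y : A} (f : X ⟶ Y) :
    ∃ w : pushout.inl f (Injective.ι X) ≫ coneConnecting f = 0,
      (ShortComplex.mk (pushout.inl f (Injective.ι X)) (coneConnecting f) w).ShortExact := by
  obtain ⟨p, w, hp, hS⟩ := exists_shortExact_of_isPushout (shortExact_cosyzygy X)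
    (IsPushout.of_hasPushout f (Injective.ι X))
  have : p = coneConnecting f := by
    apply pushout.hom_ext
    · exact w.trans (pushout.inl_desc _ _ _).symm
    · exact hp.trans (pushout.inr_desc _ _ _).symm
  subst this
  exact ⟨w, hS⟩

/-- Two pushouts of `f` along monomorphisms into injective objects are stable retracts of each
other. -/
lemma exists_stable_retract_of_isPushout {K M P I E E' : A} {f : K ⟶ M} {κ : K ⟶ P} {ι : K ⟶ I}
    {i : M ⟶ E} {b : P ⟶ E} {i' : M ⟶ E'} {b' : I ⟶ E'} [Mono κ] [Mono ι] [Injective P]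
    [Injective I] (sq : IsPushout f κ i b) (sq' : IsPushout f ι i' b') :
    ∃ (s : E' ⟶ E) (r : E ⟶ E'), FactorsThruProjective (s ≫ r - 𝟙 E') := by
  let φ : I ⟶ P := Injective.factorThru κ ι
  let ψ : P ⟶ I := Injective.factorThru ι κ
  have hφ : ι ≫ φ = κ := Injective.comp_factorThru _ _
  have hψ : κ ≫ ψ = ι := Injective.comp_factorThru _ _
  refine ⟨sq'.desc i (φ ≫ b) (by rw [reassoc_of% hφ, sq.w]),
    sq.desc i' (ψ ≫ b') (by rw [reassoc_of% hψ, sq'.w]), I, projective_of_injective I,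
    sq'.desc 0 (φ ≫ ψ - 𝟙 I) (by simp [reassoc_of% hφ, hψ]), b', ?_⟩
  apply sq'.hom_ext <;> simp [Preadditive.sub_comp, Preadditive.comp_sub]

/-- This presentation of the cone turns stable exactness at `Y` into lifting along an epimorphism
with kernel `X`. -/
lemma shortExact_biprod_cone {X Y : A} (f : X ⟶ Y) :
    ∃ w : biprod.lift f (-Injective.ι X) ≫
        biprod.desc (pushout.inl f (Injective.ι X)) (pushout.inr f (Injective.ι X)) = 0,
      (ShortComplex.mk (biprod.lift f (-Injective.ι X)) (biprod.desc _ _) w).ShortExact := by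
  have sq := IsPushout.of_hasPushout f (Injective.ι X)
  have : Mono (biprod.lift f (-Injective.ι X) ≫ biprod.snd ≫ (-𝟙 _)) := by
    have e : biprod.lift f (-Injective.ι X) ≫ biprod.snd ≫ (-𝟙 _) = Injective.ι X := by simp
    rw [e]
    infer_instance
  exact ⟨sq.shortComplex.zero,
    { exact := sq.exact_shortComplex
      mono_f := mono_of_mono _ (biprod.snd ≫ (-𝟙 _))
      epi_g := sq.epi_shortComplex_g }⟩

/-- `D ⟶ X ⟶ Y ⟶ cone f` is exact on stable morphisms out of `D`. -/
lemma exists_stable_lift_of_cone {X Y D : A} (f : X ⟶ Y) (g : D ⟶ Y)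
    (hg : FactorsThruProjective (g ≫ pushout.inl f (Injective.ι X))) :
    ∃ h : D ⟶ X, FactorsThruProjective (h ≫ f - g) := by
  obtain ⟨w, hS⟩ := shortExact_biprod_cone f
  have := hS.epi_g
  dsimp only at this
  obtain ⟨z, hz, hz'⟩ := hg.exists_lift
    (biprod.desc (pushout.inl f (Injective.ι X)) (pushout.inr f (Injective.ι X)))
  obtain ⟨h, hh⟩ := exists_factor_of_shortExact' hS (biprod.lift g 0 - z)
    (by rw [Preadditive.sub_comp, hz']; simp)
  refine ⟨h, ?_⟩
  have e := congrArg (· ≫ biprod.fst) hh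
  simp only [Category.assoc, Preadditive.sub_comp, biprod.lift_fst] at e
  rw [e, sub_sub_cancel_left]
  exact (hz.postcomp biprod.fst).neg

/-- A morphism with projective cone has a left inverse in the stable category. -/
lemma exists_stable_retraction_of_projective_cone {X Y : A} (f : X ⟶ Y) [Projective (cone f)] :
    ∃ h : Y ⟶ X, FactorsThruProjective (f ≫ h - 𝟙 X) := by
  obtain ⟨w, hS⟩ := shortExact_biprod_cone f
  have := hS.epi_g
  have := hS.mono_f
  dsimp only at *
  obtain ⟨ρ, hρ⟩ := exists_factor_of_shortExact' hS
    (𝟙 _ - biprod.desc (pushout.inl f (Injective.ι X)) (pushout.inr f (Injective.ι X)) ≫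
      Projective.factorThru (𝟙 (cone f))
      (biprod.desc (pushout.inl f (Injective.ι X)) (pushout.inr f (Injective.ι X))))
    (by simp)
  dsimp only at ρ hρ
  have h₁ : biprod.lift f (-Injective.ι X) ≫ ρ = 𝟙 X := by
    rw [← cancel_mono (biprod.lift f (-Injective.ι X)), Category.assoc, hρ]
    simp [reassoc_of% w]
  refine ⟨biprod.inl ≫ ρ, _, projective_of_injective _, Injective.ι X, biprod.inr ≫ ρ, ?_⟩
  rw [← h₁, biprod.lift_eq]
  simp

/-- A morphism whose composition with `f` is stably zero extends to the cone of `f`. -/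
lemma exists_extend_to_cone {X Y D : A} (f : X ⟶ Y) (g : Y ⟶ D)
    (hg : FactorsThruProjective (f ≫ g)) :
    ∃ k : cone f ⟶ D, pushout.inl f (Injective.ι X) ≫ k = g := by
  obtain ⟨z, -, hz⟩ := hg.exists_extend (Injective.ι X)
  exact ⟨pushout.desc g z hz.symm, pushout.inl_desc _ _ _⟩

/-! ## Construction of t-structures -/

/-- The t-structure on the stable category given by classes of objects of `A`. -/
def TStructure.ofClasses (U V : ObjectProperty A) (hom : ∀ M, U M → stableLeftPerp V M)
    (hU : IsStableUnderStableRetracts U) (hV : IsStableUnderStableRetracts V)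
    (susp : ∀ M, U M → U (cosyzygy M)) (desusp : ∀ M, V (cosyzygy M) → V M)
    (tri : ∀ M : A, ∃ (X : A) (f : X ⟶ M), U X ∧ V (cone f)) : TStructure A where
  U := stableImage U
  V := stableImage V
  U_iso := inferInstance
  V_iso := inferInstance
  hom_eq_zero X Y f hX hY := by
    obtain ⟨g, rfl⟩ := exists_toStable_map_eq (X := X.as) (Y := Y.as) f
    exact (toStable_map_eq_zero_iff _).2
      (hom X.as ((hU.stableImage_iff X.as).1 hX) Y.as ((hV.stableImage_iff Y.as).1 hY) g)
  U_suspension := hU.isSuspensionClosed_iff.2 susp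
  V_desuspension X hX := (hV.stableImage_iff X.as).2
    (desusp X.as ((hV.stableImage_iff (cosyzygy X.as)).1 hX))
  exists_triangle M := by
    obtain ⟨X, f, hX, hY⟩ := tri M.as
    refine ⟨_, _, (hU.stableImage_iff X).2 hX, (hV.stableImage_iff (cone f)).2 hY,
      (toStable A).map f, (toStable A).map (pushout.inl f (Injective.ι X)),
      (toStable A).map (coneConnecting f), X, M.as, f, Iso.refl _, Iso.refl _, Iso.refl _,
      ?_, ?_, ?_⟩
    · exact (Category.comp_id _).trans (Category.id_comp _).symm
    · exact (Category.comp_id _).trans (Category.id_comp _).symm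
    · refine Eq.trans ?_ (Category.id_comp _).symm
      rw [Iso.refl_hom, (suspension A).map_id]
      exact Category.comp_id _

lemma stableLeftPerp_cosyzygy {W : ObjectProperty A} (hW : ∀ Y, W Y → W (syzygy Y)) {M : A}
    (hM : stableLeftPerp W M) : stableLeftPerp W (cosyzygy M) := fun Y hY => by
  rw [← extOneVanishes_syzygy_iff, extOneVanishes_cosyzygy_iff]
  exact hM _ (hW Y hY)

lemma stableRightPerp_syzygy {Z : ObjectProperty A} (hZ : ∀ X, Z X → Z (cosyzygy X)) {M : A}
    (hM : stableRightPerp Z M) : stableRightPerp Z (syzygy M) := fun X hX => by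
  rw [← extOneVanishes_cosyzygy_iff, extOneVanishes_syzygy_iff]
  exact hM _ (hZ X hX)

lemma stableRightPerp_of_cosyzygy {Z : ObjectProperty A} (hZ : ∀ X, Z X → Z (cosyzygy X)) {M : A}
    (hM : stableRightPerp Z (cosyzygy M)) : stableRightPerp Z M := fun X hX => by
  rw [← extOneVanishes_cosyzygy_iff, extOneVanishes_iff_cosyzygy]
  exact hM _ (hZ X hX)

namespace IsCompleteCotorsionPair

variable {Z W : ObjectProperty A} (h : IsCompleteCotorsionPair Z W)

/-- The t-structure with aisle `Z`. -/
def leftTStructure (hZ : IsSuspensionClosed Z) : TStructure A :=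
  have hZ' := h.isStableUnderStableRetracts_left.isSuspensionClosed_iff.1 hZ
  TStructure.ofClasses Z (stableRightPerp Z) (fun M hM _ hN f => hN M hM f)
    h.isStableUnderStableRetracts_left (isStableUnderStableRetracts_stableRightPerp Z) hZ'
    (fun _ hM => stableRightPerp_of_cosyzygy hZ' hM) (fun M => by
      obtain ⟨Y, X, i, p, w, hX, hY, hS⟩ := h.exists_left M
      refine ⟨X, p, hX, fun D hD => ?_⟩
      -- The cone of `p` is a cosyzygy of `Y`, so stable morphisms into it detect `Ext¹(-, Y)`.
      obtain ⟨w', hS'⟩ := shortExact_of_isPushout_of_epi hS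
        (IsPushout.of_hasPushout p (Injective.ι X))
      have : Injective (ShortComplex.mk _ _ w').X₂ := inferInstanceAs (Injective (Injective.under X))
      exact (extOneVanishes_iff_of_injective hS').1 ((h.right_perp Y).1 hY D hD))

/-- The t-structure whose second class is `W`. -/
def rightTStructure (hW : IsLoopClosed W) : TStructure A :=
  have hW' := h.isStableUnderStableRetracts_right.isLoopClosed_iff.1 hW
  TStructure.ofClasses (stableLeftPerp W) W (fun _ hM => hM)
    (isStableUnderStableRetracts_stableLeftPerp W) h.isStableUnderStableRetracts_right
    (fun _ hM => stableLeftPerp_cosyzygy hW' hM)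
    (fun M hM => (h.isResolving hW).kernel _ (shortExact_cosyzygy M)
      ((h.isResolving hW).injective _) hM) (fun M => by
      obtain ⟨Y, X, i, p, w, hX, hY, hS⟩ := h.exists_right M
      have hK := shortExact_syzygy X
      have := hS.epi_g
      dsimp only at this
      -- The sequence `M ⟶ Y ⟶ X` is rotated: `f` is the connecting morphism `ΩX ⟶ M`, and its cone
      -- is stably `Y`.
      let β : Projective.over X ⟶ Y := Projective.factorThru (Projective.π X) p
      have hβ : β ≫ p = Projective.π X := Projective.factorThru_comp _ _
      obtain ⟨f, hf⟩ := exists_factor_of_shortExact' hS (kernel.ι (Projective.π X) ≫ β)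
        (by simp [hβ])
      dsimp only at f hf
      refine ⟨_, f, fun D hD => extOneVanishes_iff_syzygy.1 ((h.left_perp X).1 hX D hD), ?_⟩
      have sq := IsPushout.of_hasPushout f (kernel.ι (Projective.π X))
      obtain ⟨q, w', hq, hE⟩ := exists_shortExact_of_isPushout hK sq
      -- By the five lemma, the pushout of `f` along `ΩX ⟶ Projective.over X` is `Y` itself. The
      -- cone is built from another embedding of `ΩX`, hence the comparison by stable retracts
      -- below.
      let φ : ShortComplex.mk _ _ w' ⟶ ShortComplex.mk i p w :=
        { τ₁ := 𝟙 _
          τ₂ := sq.desc i β hf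
          τ₃ := 𝟙 _
          comm₁₂ := by simp
          comm₂₃ := by apply sq.hom_ext <;> simp [w, w', hβ, hq] }
      have : IsIso φ.τ₁ := inferInstanceAs (IsIso (𝟙 _))
      have : IsIso φ.τ₃ := inferInstanceAs (IsIso (𝟙 _))
      have := ShortComplex.isIso₂_of_shortExact_of_isIso₁₃ φ hE hS
      have hY' : W (pushout f (kernel.ι (Projective.π X))) :=
        h.isStableUnderStableRetracts_right.isStableUnderRetracts.of_retract
          (asIso φ.τ₂).retract hY
      have := injective_of_projective (Projective.over X)
      obtain ⟨s, r, hsr⟩ := exists_stable_retract_of_isPushout sq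
        (IsPushout.of_hasPushout f (Injective.ι _))
      exact h.isStableUnderStableRetracts_right s r hsr hY')

end IsCompleteCotorsionPair

/-! ## The classes of a t-structure -/

namespace TStructure

variable (T : TStructure A)

/-- The objects of `A` that lie in the aisle. -/
abbrev objU : ObjectProperty A := T.U.inverseImage (toStable A)

/-- The objects of `A` that lie in the class `V`. -/
abbrev objV : ObjectProperty A := T.V.inverseImage (toStable A)

lemma stableImage_objU : stableImage T.objU = T.U := by
  have := T.U_iso
  ext M
  exact ⟨fun ⟨_, hN, ⟨e⟩⟩ => T.U.prop_of_iso e hN,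
    fun h => ObjectProperty.prop_map_obj T.objU (toStable A) (X := M.as) h⟩

lemma stableImage_objV : stableImage T.objV = T.V := by
  have := T.V_iso
  ext M
  exact ⟨fun ⟨_, hN, ⟨e⟩⟩ => T.V.prop_of_iso e hN,
    fun h => ObjectProperty.prop_map_obj T.objV (toStable A) (X := M.as) h⟩

variable {T} in
lemma factorsThruProjective {M N : A} (hM : T.objU M) (hN : T.objV N) (f : M ⟶ N) :
    FactorsThruProjective f :=
  (toStable_map_eq_zero_iff f).1 (T.hom_eq_zero _ hM hN)

lemma exists_cone (M : A) : ∃ (X Y : A) (f : X ⟶ Y) (_ : (toStable A).obj M ≅ (toStable A).obj Y),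
    T.objU X ∧ T.objV (cone f) := by
  have := T.U_iso
  have := T.V_iso
  obtain ⟨X, Y, hX, hY, _, _, _, X', Y', f, a, b, c, -, -, -⟩ :=
    T.exists_triangle ((toStable A).obj M)
  exact ⟨X', Y', f, b, T.U.prop_of_iso a hX, T.V.prop_of_iso c hY⟩

/-- If `M` is left orthogonal to `V`, then `M ⟶ cone f` is stably zero, so the identity of the cone
factors stably through `ΣX ⟶ cone f`. That morphism is stably zero because `ΣX` is in `U`. The cone
is thus projective and `f` is a stable isomorphism. -/
lemma objU_eq : T.objU = stableLeftPerp T.objV := by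
  have := T.U_iso
  ext M
  refine ⟨fun hM N hN f => factorsThruProjective hM hN f, fun hM => ?_⟩
  obtain ⟨X, Y, f, e, hX, hC⟩ := T.exists_cone M
  have hY := (isStableUnderStableRetracts_stableLeftPerp T.objV).prop_of_iso e.symm hM
  obtain ⟨w, hS⟩ := shortExact_cone f
  have := hS.mono_f
  dsimp only at this
  obtain ⟨z, hz, hz'⟩ := (hY _ hC (pushout.inl f (Injective.ι X))).exists_extend
    (pushout.inl f (Injective.ι X))
  obtain ⟨s, hs⟩ := exists_factor_of_shortExact hS (𝟙 _ - z) (by simp [hz'])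
  have hs' : FactorsThruProjective s := factorsThruProjective (T.U_suspension _ hX) hC s
  have h₁ := (hs'.precomp (coneConnecting f)).add hz
  dsimp only at hs
  rw [hs, sub_add_cancel] at h₁
  have h₂ : FactorsThruProjective (𝟙 Y ≫ pushout.inl f (Injective.ι X)) := by
    simpa using h₁.precomp (pushout.inl f (Injective.ι X))
  obtain ⟨h, hh⟩ := exists_stable_lift_of_cone f (𝟙 Y) h₂
  have hP := projective_of_factorsThruProjective_id h₁
  obtain ⟨h', hh'⟩ := exists_stable_retraction_of_projective_cone f
  have e₁ := (toStable_map_eq_iff _ _).2 hh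
  have e₂ := (toStable_map_eq_iff _ _).2 hh'
  simp only [(toStable A).map_comp, (toStable A).map_id] at e₁ e₂
  have e₃ : (toStable A).map h' = (toStable A).map h := by
    rw [← Category.id_comp ((toStable A).map h'), ← e₁, Category.assoc, e₂, Category.comp_id]
  rw [e₃] at e₂
  let e' : (toStable A).obj X ≅ (toStable A).obj Y := ⟨_, _, e₂, e₁⟩
  exact T.U.prop_of_iso (e' ≪≫ e.symm) hX

/-- If `M` is right orthogonal to `U`, then `f` is stably zero and `Y ⟶ cone f` has a retraction.
The defect of its inverse factors through a morphism `ΣX ⟶ cone f`, which is stably zero. -/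
lemma objV_eq : T.objV = stableRightPerp T.objU := by
  have := T.V_iso
  ext M
  refine ⟨fun hM N hN f => factorsThruProjective hN hM f, fun hM => ?_⟩
  obtain ⟨X, Y, f, e, hX, hC⟩ := T.exists_cone M
  have hY := (isStableUnderStableRetracts_stableRightPerp T.objU).prop_of_iso e.symm hM
  obtain ⟨w, hS⟩ := shortExact_cone f
  obtain ⟨k, hk⟩ := exists_extend_to_cone f (𝟙 Y) (by simpa using hY _ hX f)
  obtain ⟨s, hs⟩ := exists_factor_of_shortExact hS (𝟙 _ - k ≫ pushout.inl f (Injective.ι X))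
    (by simp [reassoc_of% hk])
  dsimp only at s hs
  have hs' : FactorsThruProjective s := factorsThruProjective (T.U_suspension _ hX) hC s
  have h₁ := (toStable_map_eq_iff _ _).2 (hs ▸ hs'.precomp (coneConnecting f))
  have h₂ := congrArg (toStable A).map hk
  simp only [(toStable A).map_comp, (toStable A).map_id] at h₁ h₂
  let e' : (toStable A).obj Y ≅ (toStable A).obj (cone f) := ⟨_, _, h₂, h₁.symm⟩
  exact T.V.prop_of_iso (e ≪≫ e').symm hC

variable {T} in
lemma eq_of_U_eq {T' : TStructure A} (h : T.U = T'.U) : T = T' := by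
  refine TStructure.ext h ?_
  rw [← T.stableImage_objV, ← T'.stableImage_objV, T.objV_eq, T'.objV_eq, objU, h]

variable {T} in
lemma eq_of_V_eq {T' : TStructure A} (h : T.V = T'.V) : T = T' := by
  refine TStructure.ext ?_ h
  rw [← T.stableImage_objU, ← T'.stableImage_objU, T.objU_eq, T'.objU_eq, objV, h]

lemma isCoresolving_objU : IsCoresolving T.objU := by
  have h : ∀ M, T.objU M → T.objU (cosyzygy M) := fun M hM => T.U_suspension _ hM
  rw [T.objU_eq] at h ⊢
  exact isCoresolving_stableLeftPerp h

lemma isResolving_objV : IsResolving T.objV := by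
  rw [T.objV_eq]
  exact isResolving_stableRightPerp fun M hM =>
    stableRightPerp_syzygy (fun X hX => T.U_suspension _ hX) hM

lemma isStableUnderRetracts_objU : T.objU.IsStableUnderRetracts := by
  rw [T.objU_eq]
  exact (isStableUnderStableRetracts_stableLeftPerp _).isStableUnderRetracts

lemma isStableUnderRetracts_objV : T.objV.IsStableUnderRetracts := by
  rw [T.objV_eq]
  exact (isStableUnderStableRetracts_stableRightPerp _).isStableUnderRetracts

/-- The first morphism of the triangle is a precover up to stably zero error, which the projective
summand absorbs. -/
lemma isPrecovering_objU : IsPrecovering T.objU := fun M => by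
  have hU := T.isCoresolving_objU
  obtain ⟨X, Y, f, e, hX, hC⟩ := T.exists_cone M
  obtain ⟨b, hb⟩ := exists_toStable_map_eq e.hom
  obtain ⟨b', hb'⟩ := exists_toStable_map_eq e.inv
  have hbb : FactorsThruProjective (b ≫ b' - 𝟙 M) := by
    rw [← toStable_map_eq_iff, (toStable A).map_comp, hb, hb', e.hom_inv_id, (toStable A).map_id]
  refine ⟨X ⊞ Projective.over M, biprod.desc (f ≫ b') (Projective.π M),
    prop_biprod hU.extension hX (hU.projective _), fun D g hD => ?_⟩
  obtain ⟨h, hh⟩ := exists_stable_lift_of_cone f (g ≫ b) (factorsThruProjective hD hC _)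
  obtain ⟨z, -, hz⟩ := ((hh.postcomp b').add (hbb.precomp g)).exists_lift (Projective.π M)
  refine ⟨biprod.lift h (-z), ?_⟩
  rw [biprod.lift_desc, Preadditive.neg_comp, hz]
  simp

lemma isPreenveloping_objV : IsPreenveloping T.objV := fun M => by
  have hV := T.isResolving_objV
  obtain ⟨X, Y, f, e, hX, hC⟩ := T.exists_cone M
  obtain ⟨b, hb⟩ := exists_toStable_map_eq e.hom
  obtain ⟨b', hb'⟩ := exists_toStable_map_eq e.inv
  have hbb : FactorsThruProjective (b ≫ b' - 𝟙 M) := by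
    rw [← toStable_map_eq_iff, (toStable A).map_comp, hb, hb', e.hom_inv_id, (toStable A).map_id]
  refine ⟨cone f ⊞ Injective.under M,
    biprod.lift (b ≫ pushout.inl f (Injective.ι X)) (Injective.ι M),
    prop_biprod hV.extension hC (hV.injective _), fun D g hD => ?_⟩
  obtain ⟨k, hk⟩ := exists_extend_to_cone f (b' ≫ g) (factorsThruProjective hX hD _)
  obtain ⟨z, -, hz⟩ := (hbb.postcomp g).exists_extend (Injective.ι M)
  refine ⟨biprod.desc k (-z), ?_⟩
  rw [biprod.lift_desc, Preadditive.comp_neg, hz, Category.assoc, hk]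
  simp

end TStructure

/-! ## The bijections -/

lemma IsCompleteCotorsionPair.right_unique {Z W W' : ObjectProperty A}
    (h : IsCompleteCotorsionPair Z W) (h' : IsCompleteCotorsionPair Z W') : W = W' :=
  h.eq_extRightPerp.trans h'.eq_extRightPerp.symm

variable [IsIdempotentComplete (StableCategory A)]

-- Injectivity holds because the classes are recovered from their stable images; surjectivity holds
-- because `T.objU` is such a class and a t-structure is determined by its aisle.
variable (A) in
theorem exists_precoveringCoresolving_equiv :
    ∃ a : PrecoveringCoresolving A ≃ TStructure A, ∀ X, (a X).U = stableImage X.1 := by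
  have key (X : PrecoveringCoresolving A) :=
    isCompleteCotorsionPair_of_precovering X.2.1 X.2.2.1 X.2.2.2
  let F (X : PrecoveringCoresolving A) : TStructure A := (key X).leftTStructure
    (isSuspensionClosed_of_isCoresolving X.2.2.1 (key X).isStableUnderStableRetracts_left)
  refine ⟨Equiv.ofBijective F ⟨fun X X' h => Subtype.ext ?_, fun T => ?_⟩, fun X => rfl⟩
  · exact (key X).isStableUnderStableRetracts_left.eq_of_stableImage_eq
      (key X').isStableUnderStableRetracts_left (congrArg TStructure.U h)
  · exact ⟨⟨T.objU, T.isPrecovering_objU, T.isCoresolving_objU, T.isStableUnderRetracts_objU⟩,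
      TStructure.eq_of_U_eq T.stableImage_objU⟩

variable (A) in
theorem exists_preenvelopingResolving_equiv :
    ∃ c : PreenvelopingResolving A ≃ TStructure A, ∀ X, (c X).V = stableImage X.1 := by
  have key (X : PreenvelopingResolving A) :=
    isCompleteCotorsionPair_of_preenveloping X.2.1 X.2.2.1 X.2.2.2
  let F (X : PreenvelopingResolving A) : TStructure A := (key X).rightTStructure
    (isLoopClosed_of_isResolving X.2.2.1 (key X).isStableUnderStableRetracts_right)
  refine ⟨Equiv.ofBijective F ⟨fun X X' h => Subtype.ext ?_, fun T => ?_⟩, fun X => rfl⟩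
  · exact (key X).isStableUnderStableRetracts_right.eq_of_stableImage_eq
      (key X').isStableUnderStableRetracts_right (congrArg TStructure.V h)
  · exact ⟨⟨T.objV, T.isPreenveloping_objV, T.isResolving_objV, T.isStableUnderRetracts_objV⟩,
      TStructure.eq_of_V_eq T.stableImage_objV⟩

variable (A) in
theorem exists_suspensionClosedCotorsionPair_equiv :
    ∃ d : SuspensionClosedCotorsionPair A ≃ TStructure A, ∀ p, (d p).U = stableImage p.1.1 := by
  let F (p : SuspensionClosedCotorsionPair A) : TStructure A := p.2.1.leftTStructure p.2.2
  refine ⟨Equiv.ofBijective F ⟨?_, fun T => ?_⟩, fun p => rfl⟩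
  · rintro ⟨⟨Z, W⟩, h, hZ⟩ ⟨⟨Z', W'⟩, h', hZ'⟩ e
    obtain rfl : Z = Z' := h.isStableUnderStableRetracts_left.eq_of_stableImage_eq
      h'.isStableUnderStableRetracts_left (congrArg TStructure.U e)
    obtain rfl : W = W' := h.right_unique h'
    rfl
  · have h := isCompleteCotorsionPair_of_precovering T.isPrecovering_objU T.isCoresolving_objU
      T.isStableUnderRetracts_objU
    exact ⟨⟨⟨_, _⟩, h, isSuspensionClosed_of_isCoresolving T.isCoresolving_objU
      h.isStableUnderStableRetracts_left⟩, TStructure.eq_of_U_eq T.stableImage_objU⟩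

end

end FrobeniusStable

end

theorem mainTheorem5 (A : Type u) [Category.{v} A] [Abelian A] [IsFrobenius A]
    [IsIdempotentComplete (StableCategory A)] :
    (∀ X : ObjectProperty A,
      (IsPreenveloping X ∧ IsResolving X ∧ X.IsStableUnderRetracts) ↔
        ∃ Z : ObjectProperty A, IsCompleteCotorsionPair Z X ∧ IsLoopClosed X) ∧
    (∀ X : ObjectProperty A,
      (IsPrecovering X ∧ IsCoresolving X ∧ X.IsStableUnderRetracts) ↔
        ∃ Y : ObjectProperty A, IsCompleteCotorsionPair X Y ∧ IsSuspensionClosed X) ∧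
    (∀ Z W : ObjectProperty A, IsCompleteCotorsionPair Z W →
      (IsSuspensionClosed Z ↔ IsLoopClosed W)) ∧
    ∃ (a : PrecoveringCoresolving A ≃ TStructure A)
      (c : PreenvelopingResolving A ≃ TStructure A)
      (d : SuspensionClosedCotorsionPair A ≃ TStructure A),
      (∀ X, (a X).U = stableImage X.1) ∧
      (∀ X, (c X).V = stableImage X.1) ∧
      (∀ p, (d p).U = stableImage p.1.1) := by
  obtain ⟨a, ha⟩ := exists_precoveringCoresolving_equiv A
  obtain ⟨c, hc⟩ := exists_preenvelopingResolving_equiv A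
  obtain ⟨d, hd⟩ := exists_suspensionClosedCotorsionPair_equiv A
  exact ⟨fun X => preenvelopingResolving_iff X, fun X => precoveringCoresolving_iff X,
    fun _ _ h => h.isSuspensionClosed_iff_isLoopClosed, a, c, d, ha, hc, hd⟩
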